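/- Let $R$ be a commutative pro-Artinian topological ring, i.e. a commutative topological ring in which the open ideals form a base of neighborhoods of zero, which is separated and complete (the map $R\to\varprojlim_I R/I$ over all open ideals $I$ is bijective), and all of whose quotient rings $R/I$ by open ideals are Artinian. For a set $X$ let $R[[X]]$ be the set of formal linear combinations $\sum_{x\in X} r_x x$ with $r_x\in R$ such that for every open ideal $I$ all but finitely many $r_x$ lie in $I$. The functor $X\mapsto R[[X]]$ is a monad on the category of sets (the multiplication opens the parentheses); its algebras are called $R$-contramodules, and the contramodules isomorphic to $R[[X]]$ for some set $X$ are called free. An $R$-comodule is an ind-object of the category opposite to the category of discrete $R$-modules of finite length; for a comodule $\mathcal M$ denote by $\mathcal M^{\mathrm{op}}$ the corresponding pro-object. Let $\mathcal C(R)$ be the comodule with $\mathcal C(R)^{\mathrm{op}}=R$, i.e. the pro-object given by the projective system of the modules $R/I$. The comodules isomorphic to direct sums of copies of $\mathcal C(R)$ are called cofree. For comodules $\mathcal M,\mathcal N$, the set $\mathrm{Hom}_R(\mathcal M,\mathcal N)$ is a contramodule: if $\mathcal M=\varinjlim_\alpha\mathcal M_\alpha$ with $\mathcal M_\alpha$ of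 finite length, it is the projective limit of the discrete $R$-modules $\mathrm{Hom}_R(\mathcal M_\alpha,\mathcal N)$. For a contramodule $P$ and a comodule $\mathcal M=\varinjlim_\alpha\mathcal M_\alpha$ as above, the contratensor product is the comodule $P\odot_R\mathcal M=\varinjlim_\alpha P\odot_R\mathcal M_\alpha$. Here, if an open ideal $I_\alpha$ annihilates $\mathcal M_\alpha^{\mathrm{op}}$ and $I_\alpha P$ is the image of $I_\alpha[[P]]$ in $P$ under the contramodule structure map $R[[P]]\to P$, then $(P\odot_R\mathcal M_\alpha)^{\mathrm{op}}=\mathrm{Hom}_R(P/I_\alpha P,\mathcal M_\alpha^{\mathrm{op}})=\varprojlim_Q\mathrm{Hom}_R(Q,\mathcal M_\alpha^{\mathrm{op}})$ as a pro-object, $Q$ ranging over the finitely generated submodules of $P/I_\alpha P$. Put $\Phi_R(P)=\mathcal C(R)\odot_R P$ (the contratensor product of $P$ and $\mathcal C(R)$) and $\Psi_R(\mathcal M)=\mathrm{Hom}_R(\mathcal C(R),\mathcal M)$. Then the full subcategories of free $R$-contramodules and of cofree $R$-comodules are additive categories, the functor $\Phi_R$ takes free contramodules to cofree comodules, the functor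 $\Psi_R$ takes cofree comodules to free contramodules, and the restrictions of $\Phi_R$ and $\Psi_R$ are additive, mutually inverse equivalences between these two additive categories. -/

import Mathlib

open CategoryTheory CategoryTheory.Limits Opposite

universe u v w z

namespace CoContra

/-! ### Topological rings and families converging to zero -/

/-- The open ideals of a topological ring. -/
abbrev OpenIdeal (R : Type u) [CommRing R] [TopologicalSpace R] : Type u :=
  {I : Ideal R // IsOpen (I : Set R)}

/-- The projective limit of the quotient rings `R ⧸ I` over all open ideals `I`. -/
def QuotLim (R : Type u) [CommRing R] [TopologicalSpace R] : Type u :=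
  {a : ∀ I : OpenIdeal R, R ⧸ I.1 //
    ∀ (I J : OpenIdeal R) (h : I.1 ≤ J.1), Ideal.Quotient.factor h (a I) = a J}

/-- The natural map `R → lim R ⧸ I`. -/
def toQuotLim (R : Type u) [CommRing R] [TopologicalSpace R] (r : R) : QuotLim R :=
  ⟨fun I => Ideal.Quotient.mk I.1 r, fun _ _ _ => rfl⟩

/-- A commutative topological ring in which the open ideals form a base of neighborhoods of zero,
and which is separated and complete: the map `R → lim R ⧸ I` is bijective. -/
class IsLinearlyComplete (R : Type u) [CommRing R] [TopologicalSpace R] : Prop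
    extends IsTopologicalRing R where
  exists_openIdeal_subset : ∀ U ∈ nhds (0 : R), ∃ I : OpenIdeal R, (I.1 : Set R) ⊆ U
  bijective_toQuotLim : Function.Bijective (toQuotLim R)

/-- A pro-Artinian topological ring: its discrete quotient rings are Artinian. -/
class IsProArtinian (R : Type u) [CommRing R] [TopologicalSpace R] : Prop
    extends IsLinearlyComplete R where
  isArtinianRing_quotient : ∀ I : OpenIdeal R, IsArtinianRing (R ⧸ I.1)

section Families

variable {R : Type u} [CommRing R] [TopologicalSpace R]

/-- A family of elements of `R` converges to zero if each open ideal contains all but finitely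
many of its members. -/
def ConvToZero {X : Type v} (t : X → R) : Prop :=
  ∀ I : OpenIdeal R, {x | t x ∉ I.1}.Finite

variable (R) in
/-- `R[[X]]`: the formal linear combinations `∑ r_x x` whose family of coefficients converges
to zero. -/
def Lin (X : Type v) : Submodule R (X → R) where
  carrier := {t | ConvToZero t}
  zero_mem' I := by simp
  add_mem' {s t} hs ht I := ((hs I).union (ht I)).subset fun x hx => by
    by_contra h
    simp only [Set.mem_union, Set.mem_ofPred_eq, not_or, not_not] at h
    exact hx (I.1.add_mem h.1 h.2)
  smul_mem' r t ht I := (ht I).subset fun x hx h => hx (I.1.mul_mem_left r h)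

variable [IsLinearlyComplete R]

theorem eq_of_forall_sub_mem {a b : R} (h : ∀ I : OpenIdeal R, a - b ∈ I.1) : a = b :=
  (IsLinearlyComplete.bijective_toQuotLim (R := R)).1 <| Subtype.ext <| funext fun I =>
    (Ideal.Quotient.mk_eq_mk_iff_sub_mem _ _).2 (h I)

instance instT2Space : T2Space R := by
  refine IsTopologicalAddGroup.t2Space_of_zero_sep fun x hx => ?_
  by_contra! h
  refine hx (eq_of_forall_sub_mem fun I => ?_)
  rw [sub_zero]
  exact h _ (I.2.mem_nhds I.1.zero_mem)

theorem ConvToZero.exists_sum {X : Type v} {t : X → R} (ht : ConvToZero t) :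
    ∃ b : R, ∀ (I : OpenIdeal R) (F : Finset X), (∀ x ∉ F, t x ∈ I.1) →
      b - ∑ x ∈ F, t x ∈ I.1 := by
  classical
  have key : ∀ (I : OpenIdeal R) (F G : Finset X), (∀ x ∉ F, t x ∈ I.1) →
      (∀ x ∉ G, t x ∈ I.1) → ∑ x ∈ F, t x - ∑ x ∈ G, t x ∈ I.1 := by
    have key' : ∀ (I : OpenIdeal R) (F G : Finset X), F ⊆ G → (∀ x ∉ F, t x ∈ I.1) →
        ∑ x ∈ G, t x - ∑ x ∈ F, t x ∈ I.1 := by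
      intro I F G hFG hF
      rw [← Finset.sum_sdiff hFG, add_sub_cancel_right]
      exact I.1.sum_mem fun x hx => hF x (Finset.mem_sdiff.1 hx).2
    intro I F G hF hG
    have h1 := key' I F (F ∪ G) Finset.subset_union_left hF
    have h2 := key' I G (F ∪ G) Finset.subset_union_right hG
    have := I.1.sub_mem h2 h1
    rwa [sub_sub_sub_cancel_left] at this
  let S : OpenIdeal R → Finset X := fun I => (ht I).toFinset
  have hS : ∀ I, ∀ x ∉ S I, t x ∈ I.1 := fun I x hx => by
    simpa [S] using hx
  obtain ⟨b, hb⟩ := (IsLinearlyComplete.bijective_toQuotLim (R := R)).2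
    ⟨fun I => Ideal.Quotient.mk I.1 (∑ x ∈ S I, t x), fun I J h => by
      rw [Ideal.Quotient.factor_mk]
      exact (Ideal.Quotient.mk_eq_mk_iff_sub_mem _ _).2
        (key J _ _ (fun x hx => h (hS I x hx)) (hS J))⟩
  refine ⟨b, fun I F hF => ?_⟩
  have h1 : b - ∑ x ∈ S I, t x ∈ I.1 :=
    (Ideal.Quotient.mk_eq_mk_iff_sub_mem _ _).1 (congrFun (congrArg Subtype.val hb) I)
  have := I.1.add_mem h1 (key I _ F (hS I) hF)
  rwa [sub_add_sub_cancel] at this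

theorem ConvToZero.hasSum {X : Type v} {t : X → R} (ht : ConvToZero t) {b : R}
    (hb : ∀ (I : OpenIdeal R) (F : Finset X), (∀ x ∉ F, t x ∈ I.1) →
      b - ∑ x ∈ F, t x ∈ I.1) : HasSum t b := by
  rw [HasSum, SummationFilter.unconditional_filter]
  refine Filter.tendsto_iff_forall_eventually_mem.2 fun U hU => ?_
  have hU' : (fun x => b - x) ⁻¹' U ∈ nhds (0 : R) := by
    refine (continuous_const.sub continuous_id).continuousAt.preimage_mem_nhds ?_
    simpa using hU
  obtain ⟨I, hI⟩ := IsLinearlyComplete.exists_openIdeal_subset _ hU'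
  filter_upwards [Filter.eventually_ge_atTop (ht I).toFinset] with F hF
  have := hI (hb I F fun x hx => by
    by_contra h
    exact hx (hF ((ht I).mem_toFinset.2 h)))
  simpa using this

/-- Modulo an open ideal, the sum of a family converging to zero is a finite sum. -/
theorem ConvToZero.tsum_sub_mem {X : Type v} {t : X → R} (ht : ConvToZero t) (I : OpenIdeal R)
    (F : Finset X) (hF : ∀ x ∉ F, t x ∈ I.1) : ∑' x, t x - ∑ x ∈ F, t x ∈ I.1 := by
  obtain ⟨b, hb⟩ := ht.exists_sum
  rw [(ht.hasSum hb).tsum_eq]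
  exact hb I F hF

theorem ConvToZero.mul_left {X : Type v} {t : X → R} (ht : ConvToZero t) (k : X → R) :
    ConvToZero fun x => t x * k x :=
  fun I => (ht I).subset fun _ hx h => hx (I.1.mul_mem_right _ h)

namespace Lin

/-- The reduction `R[[X]] → (R ⧸ I)[X]` modulo an open ideal. -/
noncomputable def red {X : Type v} (I : OpenIdeal R) : Lin R X →ₗ[R] X →₀ R ⧸ I.1 where
  toFun t := Finsupp.ofSupportFinite (fun x => Ideal.Quotient.mk I.1 (t.1 x)) <|
    (t.2 I).subset fun x hx h => hx (Ideal.Quotient.eq_zero_iff_mem.2 h)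
  map_add' s t := by ext; simp [Finsupp.ofSupportFinite_coe]
  map_smul' r t := by
    ext x
    simp [Finsupp.ofSupportFinite_coe, Algebra.smul_def]

@[simp]
theorem red_apply {X : Type v} (I : OpenIdeal R) (t : Lin R X) (x : X) :
    red I t x = Ideal.Quotient.mk I.1 (t.1 x) := rfl

theorem ext_red {X : Type v} {s t : Lin R X} (h : ∀ I, red I s = red I t) : s = t :=
  Subtype.ext <| funext fun x => eq_of_forall_sub_mem fun I =>
    (Ideal.Quotient.mk_eq_mk_iff_sub_mem _ _).1 (DFunLike.congr_fun (h I) x)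

variable (R) in
/-- The embedding `X → R[[X]]`. -/
noncomputable def unit {X : Type v} (x : X) : Lin R X := by
  classical
  exact ⟨Pi.single x 1, fun I => (Set.finite_singleton x).subset fun y hy => by
    by_contra h
    exact hy (by rw [Pi.single_eq_of_ne h]; exact I.1.zero_mem)⟩

theorem red_unit {X : Type v} (I : OpenIdeal R) (x : X) :
    red I (unit R x) = Finsupp.single x 1 := by
  classical
  ext y
  simp only [red_apply, unit]
  rw [Pi.single_apply, Finsupp.single_apply]
  by_cases h : y = x
  · simp [h]
  · simp [h, Ne.symm h]

/-- The family of sums `∑_x t_x k_x`, for `t ∈ R[[X]]` and a family of elements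
`k_x ∈ R[[Y]]`, computed coefficientwise. -/
noncomputable def bind {X : Type v} {Y : Type w} (t : Lin R X) (k : X → Lin R Y) : Lin R Y :=
  ⟨fun y => ∑' x, t.1 x * (k x).1 y, fun I => by
    refine ((t.2 I).biUnion fun x _ => (k x).2 I).subset fun y hy => ?_
    by_contra h
    simp only [Set.mem_iUnion, Set.mem_ofPred_eq, not_exists, not_not] at h
    refine hy ?_
    have := (t.2.mul_left fun x => (k x).1 y).tsum_sub_mem I ∅ fun x _ => by
      by_cases hx : t.1 x ∈ I.1
      · exact I.1.mul_mem_right _ hx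
      · exact I.1.mul_mem_left _ (h x hx)
    simpa using this⟩

theorem red_bind {X : Type v} {Y : Type w} (I : OpenIdeal R) (t : Lin R X) (k : X → Lin R Y) :
    red I (bind t k) = Finsupp.linearCombination (R ⧸ I.1) (fun x => red I (k x)) (red I t) := by
  ext y
  rw [Finsupp.linearCombination_apply, Finsupp.sum, Finsupp.finsetSum_apply]
  have h := (t.2.mul_left fun x => (k x).1 y).tsum_sub_mem I (red I t).support fun x hx => by
    rw [Finsupp.notMem_support_iff, red_apply, Ideal.Quotient.eq_zero_iff_mem] at hx
    exact I.1.mul_mem_right _ hx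
  rw [← Ideal.Quotient.mk_eq_mk_iff_sub_mem] at h
  rw [red_apply]
  refine h.trans ?_
  simp

theorem bind_unit {X : Type v} (t : Lin R X) : bind t (unit R) = t := by
  refine ext_red fun I => ?_
  rw [red_bind]
  simp only [red_unit]
  simp [Finsupp.linearCombination_apply]

theorem unit_bind {X : Type v} {Y : Type w} (x : X) (k : X → Lin R Y) :
    bind (unit R x) k = k x := by
  refine ext_red fun I => ?_
  rw [red_bind, red_unit]
  simp

theorem bind_bind {X : Type v} {Y : Type w} {Z : Type z} (t : Lin R X) (k : X → Lin R Y)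
    (l : Y → Lin R Z) : bind (bind t k) l = bind t fun x => bind (k x) l := by
  refine ext_red fun I => ?_
  rw [red_bind, red_bind, red_bind, Finsupp.apply_linearCombination]
  congr 2
  funext x
  exact (red_bind I (k x) l).symm

theorem bind_add_right {X : Type v} {Y : Type w} (t : Lin R X) (k l : X → Lin R Y) :
    bind t (fun x => k x + l x) = bind t k + bind t l := by
  refine ext_red fun I => ?_
  rw [map_add, red_bind, red_bind, red_bind]
  simp [Finsupp.linearCombination_apply, Finsupp.sum_add]

theorem bind_smul_right {X : Type v} {Y : Type w} (r : R) (t : Lin R X) (k : X → Lin R Y) :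
    bind t (fun x => r • k x) = r • bind t k := by
  refine ext_red fun I => ?_
  rw [map_smul, red_bind, red_bind]
  simp [Finsupp.linearCombination_apply, Finsupp.smul_sum, smul_comm r]

theorem add_bind {X : Type v} {Y : Type w} (s t : Lin R X) (k : X → Lin R Y) :
    bind (s + t) k = bind s k + bind t k := by
  refine ext_red fun I => ?_
  rw [map_add, red_bind, red_bind, red_bind, map_add, map_add]

theorem smul_bind {X : Type v} {Y : Type w} (r : R) (t : Lin R X) (k : X → Lin R Y) :
    bind (r • t) k = r • bind t k := by
  refine ext_red fun I => ?_
  rw [map_smul, red_bind, red_bind, map_smul]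
  exact map_smul (Finsupp.linearCombination (R ⧸ I.1) _) (Ideal.Quotient.mk I.1 r) (red I t)

/-- The map `R[[X]] → R[[Y]]` induced by a map of sets `X → Y`. -/
noncomputable def map {X : Type v} {Y : Type w} (f : X → Y) (t : Lin R X) : Lin R Y :=
  bind t fun x => unit R (f x)

/-- The opening of parentheses `R[[R[[X]]]] → R[[X]]`,
`∑_y r_y y ↦ ∑_x (∑_y r_y r_{yx}) x`, where `y = ∑_x r_{yx} x`. -/
noncomputable def join {X : Type v} (t : Lin R (Lin R X)) : Lin R X :=
  bind t id

theorem join_apply {X : Type v} (t : Lin R (Lin R X)) (x : X) :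
    (join t).1 x = ∑' y : Lin R X, t.1 y * y.1 x := rfl

/-- The coefficient of `map f t` at `y` is the sum of the coefficients of `t` over the fiber. -/
theorem map_apply {X : Type v} {Y : Type w} (f : X → Y) (t : Lin R X) (y : Y) :
    (map f t).1 y = ∑' x : f ⁻¹' {y}, t.1 x := by
  classical
  rw [tsum_subtype (f ⁻¹' {y}) t.1]
  refine tsum_congr fun x => ?_
  simp only [unit, Set.indicator_apply, Set.mem_preimage, Set.mem_singleton_iff, Pi.single_apply]
  by_cases h : f x = y
  · simp [h]
  · simp [h, Ne.symm h]

theorem bind_mem {X : Type v} {Y : Type w} (t : Lin R X) (k : X → Lin R Y) (I : OpenIdeal R)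
    (ht : ∀ x, t.1 x ∈ I.1) (y : Y) : (bind t k).1 y ∈ I.1 := by
  change ∑' x, t.1 x * (k x).1 y ∈ I.1
  simpa using (t.2.mul_left fun x => (k x).1 y).tsum_sub_mem I ∅ fun x _ =>
    I.1.mul_mem_right _ (ht x)

end Lin

end Families

section Monad

variable (R : Type u) [CommRing R] [TopologicalSpace R] [IsLinearlyComplete R]

/-- The monad `X ↦ R[[X]]` on the category of sets. -/
noncomputable def linMonad : Monad (Type u) where
  obj X := Lin R X
  map f := ↾(Lin.map f)
  map_id X := by
    refine ConcreteCategory.hom_ext _ _ fun t => ?_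
    exact Lin.bind_unit t
  map_comp f g := by
    refine ConcreteCategory.hom_ext _ _ fun t => ?_
    simp [Lin.map, Lin.bind_bind, Lin.unit_bind]
  η := { app := fun X => ↾(Lin.unit R)
         naturality := fun X Y f => by
          refine ConcreteCategory.hom_ext _ _ fun x => ?_
          simp [Lin.map, Lin.unit_bind] }
  μ := { app := fun X => ↾Lin.join
         naturality := fun X Y f => by
          refine ConcreteCategory.hom_ext _ _ fun t => ?_
          simp [Lin.map, Lin.join, Lin.unit_bind, Lin.bind_bind] }
  assoc X := by
    refine ConcreteCategory.hom_ext _ _ fun t => ?_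
    simp [Lin.map, Lin.join, Lin.unit_bind, Lin.bind_bind]
  left_unit X := by
    refine ConcreteCategory.hom_ext _ _ fun t => ?_
    simp [Lin.join, Lin.unit_bind]
  right_unit X := by
    refine ConcreteCategory.hom_ext _ _ fun t => ?_
    simp [Lin.map, Lin.join, Lin.bind_bind, Lin.unit_bind, Lin.bind_unit]

/-- The category of contramodules over `R`. -/
abbrev Contra : Type (u + 1) := (linMonad R).Algebra

namespace Contra

variable {R}

/-- The contraaction map `R[[P]] → P`. -/
def act (P : Contra R) (t : Lin R P.A) : P.A := P.a t

theorem act_unit (P : Contra R) (p : P.A) : P.act (Lin.unit R p) = p :=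
  ConcreteCategory.congr_hom P.unit p

theorem act_join (P : Contra R) (t : Lin R (Lin R P.A)) :
    P.act (Lin.join t) = P.act (Lin.map P.act t) :=
  ConcreteCategory.congr_hom P.assoc t

theorem act_bind (P : Contra R) {X : Type v} (t : Lin R X) (k : X → Lin R P.A) :
    P.act (Lin.bind t k) = P.act (Lin.map (fun x => P.act (k x)) t) := by
  have h := P.act_join (Lin.map k t)
  simpa only [Lin.join, Lin.map, Lin.bind_bind, Lin.unit_bind, id] using h

theorem hom_act {P Q : Contra R} (f : P ⟶ Q) (t : Lin R P.A) :
    f.f (P.act t) = Q.act (Lin.map f.f t) :=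
  (ConcreteCategory.congr_hom f.h t).symm

noncomputable section

variable (P : Contra R)

instance : Zero P.A := ⟨P.act 0⟩
instance : Add P.A := ⟨fun p q => P.act (Lin.unit R p + Lin.unit R q)⟩
instance : Neg P.A := ⟨fun p => P.act (-Lin.unit R p)⟩
instance : Sub P.A := ⟨fun p q => P.act (Lin.unit R p - Lin.unit R q)⟩
instance instSMulR : SMul R P.A := ⟨fun r p => P.act (r • Lin.unit R p)⟩
instance instSMulNat : SMul ℕ P.A := ⟨fun n p => P.act (n • Lin.unit R p)⟩
instance instSMulInt : SMul ℤ P.A := ⟨fun n p => P.act (n • Lin.unit R p)⟩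

theorem act_zero : P.act 0 = 0 := rfl

theorem act_smul (r : R) (t : Lin R P.A) : P.act (r • t) = r • P.act t := by
  have h := P.act_bind (r • Lin.unit R (PUnit.unit : PUnit.{1})) fun _ => t
  simp only [Lin.map, Lin.smul_bind, Lin.unit_bind] at h
  exact h

theorem act_add (s t : Lin R P.A) : P.act (s + t) = P.act s + P.act t := by
  have h := P.act_bind (Lin.unit R true + Lin.unit R false) fun b => if b then s else t
  simp only [Lin.map, Lin.add_bind, Lin.unit_bind] at h
  exact h

theorem act_neg (t : Lin R P.A) : P.act (-t) = -P.act t := by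
  have h := P.act_smul (-1) t
  rw [neg_one_smul R t] at h
  rw [h]
  exact congrArg P.act (neg_one_smul R (Lin.unit R (P.act t)))

theorem act_sub (s t : Lin R P.A) : P.act (s - t) = P.act s - P.act t := by
  have h := P.act_bind (Lin.unit R true + (-1 : R) • Lin.unit R false)
    fun b => if b then s else t
  simp only [Lin.map, Lin.add_bind, Lin.smul_bind, Lin.unit_bind] at h
  have h' : P.act (s + (-1 : R) • t) =
    P.act (Lin.unit R (P.act s) + (-1 : R) • Lin.unit R (P.act t)) := h
  rw [neg_one_smul R t, neg_one_smul R (Lin.unit R (P.act t)), ← sub_eq_add_neg,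
    ← sub_eq_add_neg] at h'
  exact h'

theorem act_nsmul (t : Lin R P.A) (n : ℕ) : P.act (n • t) = n • P.act t := by
  have h := P.act_smul (n : R) t
  rw [Nat.cast_smul_eq_nsmul R n t] at h
  rw [h]
  exact congrArg P.act (Nat.cast_smul_eq_nsmul R n (Lin.unit R (P.act t)))

theorem act_zsmul (t : Lin R P.A) (n : ℤ) : P.act (n • t) = n • P.act t := by
  have h := P.act_smul (n : R) t
  rw [Int.cast_smul_eq_zsmul R n t] at h
  rw [h]
  exact congrArg P.act (Int.cast_smul_eq_zsmul R n (Lin.unit R (P.act t)))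

theorem act_surjective : Function.Surjective P.act :=
  fun p => ⟨Lin.unit R p, P.act_unit p⟩

/-- The underlying abelian group of a contramodule: `p + q` is the value of the contraaction on
the formal linear combination `1 p + 1 q`. -/
instance instAddCommGroup : AddCommGroup P.A :=
  P.act_surjective.addCommGroup P.act P.act_zero P.act_add P.act_neg P.act_sub P.act_nsmul
    P.act_zsmul

/-- The underlying `R`-module of a contramodule: `r • p` is the value of the contraaction on
the formal linear combination `r p`. -/
instance instModule : Module R P.A :=
  P.act_surjective.module R (⟨⟨P.act, P.act_zero⟩, P.act_add⟩ : Lin R P.A →+ P.A) P.act_smul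

theorem smul_def (r : R) (p : P.A) : r • p = P.act (r • Lin.unit R p) := rfl
theorem add_def (p q : P.A) : p + q = P.act (Lin.unit R p + Lin.unit R q) := rfl

/-- The underlying `R`-linear map of a morphism of contramodules. -/
def homLinear {P Q : Contra R} (f : P ⟶ Q) : P.A →ₗ[R] Q.A where
  toFun := f.f
  map_add' p q := by
    rw [add_def, hom_act]
    simp only [Lin.map, Lin.add_bind, Lin.unit_bind]
    rfl
  map_smul' r p := by
    rw [smul_def, hom_act]
    simp only [Lin.map, Lin.smul_bind, Lin.unit_bind]
    rfl

/-- A map of underlying sets that commutes with the contraactions. -/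
def homMk {P Q : Contra R} (f : P.A → Q.A)
    (h : ∀ t, f (P.act t) = Q.act (Lin.map f t)) : P ⟶ Q where
  f := ↾f
  h := ConcreteCategory.hom_ext _ _ fun t => (h t).symm

theorem act_map_add {X : Type v} (f g : X → P.A) (t : Lin R X) :
    P.act (Lin.map (fun x => f x + g x) t) = P.act (Lin.map f t) + P.act (Lin.map g t) := by
  have h := P.act_bind t fun x => Lin.unit R (f x) + Lin.unit R (g x)
  rw [Lin.bind_add_right, act_add] at h
  exact h.symm

theorem act_map_smul {X : Type v} (r : R) (f : X → P.A) (t : Lin R X) :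
    P.act (Lin.map (fun x => r • f x) t) = r • P.act (Lin.map f t) := by
  have h := P.act_bind t fun x => r • Lin.unit R (f x)
  rw [Lin.bind_smul_right, act_smul] at h
  exact h.symm

instance instZeroHom (P Q : Contra R) : Zero (P ⟶ Q) :=
  ⟨homMk (fun _ => 0) fun t => by
    simpa using (Q.act_map_smul 0 (fun _ => 0) t).symm⟩
instance instAddHom (P Q : Contra R) : Add (P ⟶ Q) :=
  ⟨fun f g => homMk (fun p => homLinear f p + homLinear g p) fun t => by
    rw [act_map_add]
    exact congrArg₂ _ (hom_act f t) (hom_act g t)⟩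
instance instSMulHom (P Q : Contra R) : SMul R (P ⟶ Q) :=
  ⟨fun r f => homMk (fun p => r • homLinear f p) fun t => by
    rw [act_map_smul]
    exact congrArg _ (hom_act f t)⟩
instance instNegHom (P Q : Contra R) : Neg (P ⟶ Q) := ⟨fun f => (-1 : R) • f⟩
instance instSubHom (P Q : Contra R) : Sub (P ⟶ Q) := ⟨fun f g => f + -g⟩
instance instSMulNatHom (P Q : Contra R) : SMul ℕ (P ⟶ Q) := ⟨fun n f => (n : R) • f⟩
instance instSMulIntHom (P Q : Contra R) : SMul ℤ (P ⟶ Q) := ⟨fun n f => (n : R) • f⟩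

theorem homLinear_injective (P Q : Contra R) :
    Function.Injective (homLinear : (P ⟶ Q) → (P.A →ₗ[R] Q.A)) := fun f g h => by
  ext p
  exact LinearMap.congr_fun h p

/-- Addition of morphisms of contramodules is pointwise. -/
instance instAddCommGroupHom (P Q : Contra R) : AddCommGroup (P ⟶ Q) :=
  (homLinear_injective P Q).addCommGroup homLinear rfl (fun _ _ => rfl)
    (fun f => (neg_one_smul R (homLinear f) : _))
    (fun f g => by
      rw [sub_eq_add_neg, ← neg_one_smul R (homLinear g)]; rfl)
    (fun f n => (Nat.cast_smul_eq_nsmul R n (homLinear f) : _))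
    (fun f n => (Int.cast_smul_eq_zsmul R n (homLinear f) : _))

instance instPreadditive : Preadditive (Contra R) where
  homGroup := instAddCommGroupHom
  add_comp _ _ _ f f' g := homLinear_injective _ _ <| LinearMap.ext fun p =>
    map_add (homLinear g) (homLinear f p) (homLinear f' p)
  comp_add _ _ _ _ _ _ := rfl

end

/-- The free contramodule `R[[X]]` on a set `X`. -/
noncomputable abbrev free (R : Type u) [CommRing R] [TopologicalSpace R] [IsLinearlyComplete R]
    (X : Type u) : Contra R := (linMonad R).free.obj X

/-- A contramodule is free if it is isomorphic to `R[[X]]` for some set `X`. -/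
def isFree (R : Type u) [CommRing R] [TopologicalSpace R] [IsLinearlyComplete R] :
    ObjectProperty (Contra R) := fun P => ∃ X : Type u, Nonempty (P ≅ free R X)

end Contra

end Monad

section FinMod

variable (R : Type u) [CommRing R] [TopologicalSpace R]

/-- The property of an `R`-module of being discrete (all annihilators of elements are open)
and of finite length. -/
def isFin : ObjectProperty (ModuleCat.{u} R) := fun M =>
  IsFiniteLength R M ∧ ∀ m : M, IsOpen {r : R | r • m = 0}

/-- The category of discrete `R`-modules of finite length. -/
abbrev FinMod : Type (u + 1) := (isFin R).FullSubcategory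

variable {R}

theorem isFin_of_injective {M N : ModuleCat.{u} R} (f : M →ₗ[R] N) (hf : Function.Injective f)
    (hN : isFin R N) : isFin R M :=
  ⟨hN.1.of_injective hf, fun m => by
    convert hN.2 (f m) using 3
    rw [← map_smul, map_eq_zero_iff f hf]⟩

theorem isFin_of_surjective [IsTopologicalRing R] {M N : ModuleCat.{u} R} (f : M →ₗ[R] N)
    (hf : Function.Surjective f) (hM : isFin R M) : isFin R N :=
  ⟨hM.1.of_surjective hf, fun n => by
    obtain ⟨m, rfl⟩ := hf n
    have h : (LinearMap.toSpanSingleton R M m).ker ≤ (LinearMap.toSpanSingleton R N (f m)).ker :=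
      fun r hr => by
        simp only [LinearMap.mem_ker, LinearMap.toSpanSingleton_apply] at hr ⊢
        rw [← map_smul, hr, map_zero]
    exact AddSubgroup.isOpen_mono (H₁ := (LinearMap.toSpanSingleton R M m).ker.toAddSubgroup)
      (H₂ := (LinearMap.toSpanSingleton R N (f m)).ker.toAddSubgroup) h (hM.2 m)⟩

theorem isFin_pi {J : Type} [Finite J] (M : J → ModuleCat.{u} R) (hM : ∀ j, isFin R (M j)) :
    isFin R (ModuleCat.of R (∀ j, M j)) := by
  refine ⟨?_, fun m => ?_⟩
  · rw [isFiniteLength_iff_isNoetherian_isArtinian]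
    have h1 := fun j => (isFiniteLength_iff_isNoetherian_isArtinian.1 (hM j).1).1
    have h2 := fun j => (isFiniteLength_iff_isNoetherian_isArtinian.1 (hM j).1).2
    exact ⟨isNoetherian_pi, inferInstance⟩
  · have : {r : R | r • m = 0} = ⋂ j, {r : R | r • m j = 0} := by
      ext r
      rw [Set.mem_iInter]
      exact funext_iff
    rw [this]
    exact isOpen_iInter_of_finite fun j => (hM j).2 _

instance : (isFin R).ContainsZero where
  exists_zero := ⟨ModuleCat.of R PUnit, ModuleCat.isZero_of_subsingleton _,
    .of_subsingleton, fun m => by simp⟩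

instance : (isFin R).IsClosedUnderSubobjects where
  prop_of_mono f _ h := isFin_of_injective f.hom ((ModuleCat.mono_iff_injective f).1 ‹_›) h

instance [IsTopologicalRing R] : (isFin R).IsClosedUnderQuotients where
  prop_of_epi f _ h := isFin_of_surjective f.hom ((ModuleCat.epi_iff_surjective f).1 ‹_›) h

instance : (isFin R).IsClosedUnderFiniteProducts where
  isClosedUnderLimitsOfShape J _ := .mk' (by
    rintro _ ⟨F, hF⟩
    refine isFin_of_injective (N := ModuleCat.of R (∀ j : J, F.obj ⟨j⟩))
      (LinearMap.pi fun j => (limit.π F ⟨j⟩).hom) (fun x y h => ?_)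
      (isFin_pi _ fun j => hF ⟨j⟩)
    refine Concrete.limit_ext F x y fun j => ?_
    exact congrFun h j.as)

theorem isFin_le_isFG : isFin R ≤ ModuleCat.isFG R := fun _ h =>
  have := (isFiniteLength_iff_isNoetherian_isArtinian.1 h.1).1
  inferInstanceAs (Module.Finite R _)

instance instEssentiallySmallFinMod : EssentiallySmall.{u} (FinMod R) :=
  essentiallySmall_of_fully_faithful (ObjectProperty.ιOfLE (isFin_le_isFG (R := R)))

noncomputable instance [IsTopologicalRing R] : Abelian (FinMod R) := inferInstance

end FinMod

section IndHom

variable {C : Type w} [Category.{v} C]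

/-- A morphism of ind-objects is uniquely determined by its effect on morphisms from objects. -/
theorem existsUnique_ind_hom {M N : Ind C}
    (φ : ∀ X : C, (Ind.yoneda.obj X ⟶ M) → (Ind.yoneda.obj X ⟶ N))
    (hφ : ∀ (X Y : C) (u : X ⟶ Y) (x : Ind.yoneda.obj Y ⟶ M),
      φ X (Ind.yoneda.map u ≫ x) = Ind.yoneda.map u ≫ φ Y x) :
    ∃! g : M ⟶ N, ∀ (X : C) (x : Ind.yoneda.obj X ⟶ M), x ≫ g = φ X x := by
  let i := Ind.yonedaCompInclusion (C := C)
  let e (M : Ind C) (X : C) : (Ind.yoneda.obj X ⟶ M) ≃ ((Ind.inclusion C).obj M).obj (op X) :=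
    ((Ind.inclusion.fullyFaithful (C := C)).homEquiv.trans
      ((i.app X).homCongr (Iso.refl _))).trans yonedaEquiv
  have he : ∀ (M : Ind C) (X Y : C) (u : X ⟶ Y) (x : Ind.yoneda.obj Y ⟶ M),
      e M X (Ind.yoneda.map u ≫ x) = ((Ind.inclusion C).obj M).map u.op (e M Y x) := by
    intro M X Y u x
    have h := i.inv.naturality u
    simp only [e, Equiv.trans_apply, Functor.FullyFaithful.homEquiv_apply, Functor.map_comp,
      Iso.homCongr_apply, Iso.refl_hom, Category.comp_id, Iso.app_inv]
    rw [yonedaEquiv_naturality]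
    congr 1
    rw [← Category.assoc, ← Category.assoc]
    congr 1
    exact h.symm
  have he' : ∀ (M N : Ind C) (X : C) (x : Ind.yoneda.obj X ⟶ M) (g : M ⟶ N),
      e N X (x ≫ g) = ((Ind.inclusion C).map g).app (op X) (e M X x) := by
    intro M N X x g
    simp only [e, Equiv.trans_apply, Functor.FullyFaithful.homEquiv_apply, Functor.map_comp,
      Iso.homCongr_apply, Iso.refl_hom, Category.comp_id, Iso.app_inv]
    rw [← yonedaEquiv_comp, Category.assoc]
  refine ⟨Ind.inclusion.fullyFaithful.preimage
    { app := fun X => ↾fun m => e N X.unop (φ X.unop ((e M X.unop).symm m))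
      naturality := fun X Y u => ?_ }, fun X x => ?_, fun g hg => ?_⟩
  · refine ConcreteCategory.hom_ext _ _ fun m => ?_
    obtain ⟨x, rfl⟩ := (e M X.unop).surjective m
    have h := he M _ _ u.unop x
    simp only [Quiver.Hom.op_unop] at h
    simp only [types_comp_apply, TypeCat.ofHom_apply]
    erw [← h]
    simp only [Equiv.symm_apply_apply]
    rw [hφ, he]
    rfl
  · apply (e N X).injective
    rw [he', Functor.FullyFaithful.map_preimage]
    simp
  · apply Ind.inclusion.fullyFaithful.map_injective
    rw [Functor.FullyFaithful.map_preimage]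
    ext X m
    obtain ⟨x, rfl⟩ := (e M X.unop).surjective m
    have := he' M N X.unop x g
    refine this.symm.trans ?_
    rw [hg]
    exact congrArg (fun y => e N X.unop (φ X.unop y)) ((e M X.unop).symm_apply_apply x).symm

end IndHom

section IndPreadditive

variable (C : Type w) [Category.{v} C] [EssentiallySmall.{v} C]

theorem isIndObject_comp_equivSmallModel {A : Cᵒᵖ ⥤ Type v} (hA : IsIndObject A) :
    IsIndObject ((equivSmallModel.{v} C).inverse.op ⋙ A) := by
  obtain ⟨⟨P⟩⟩ := hA
  let e := equivSmallModel.{v} C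
  let W := (Functor.whiskeringLeft _ _ (Type v)).obj e.inverse.op
  let i : e.functor ⋙ yoneda ≅ yoneda ⋙ W := e.symm.toAdjunction.compYonedaIso
  have h : IsColimit (W.mapCocone P.cocone) := isColimitOfPreserves W P.coconeIsColimit
  let j : (P.F ⋙ e.functor) ⋙ yoneda ≅ (P.F ⋙ yoneda) ⋙ W :=
    Functor.isoWhiskerLeft P.F i
  have h' := (IsColimit.precomposeHomEquiv j (W.mapCocone P.cocone)).symm h
  exact ⟨⟨.ofCocone _ h'⟩⟩

/-- Restriction of ind-objects along the equivalence of an essentially small category with its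
small model. -/
noncomputable def indToSmallModel : Ind C ⥤ Ind (SmallModel.{v} C) :=
  (Ind.equivalence C).functor ⋙
    ObjectProperty.lift _ (ObjectProperty.ι _ ⋙
        (Functor.whiskeringLeft _ _ (Type v)).obj (equivSmallModel.{v} C).inverse.op)
      (fun A => isIndObject_comp_equivSmallModel C A.property) ⋙
    (Ind.equivalence (SmallModel.{v} C)).inverse

instance : (indToSmallModel C).Full := by
  unfold indToSmallModel
  infer_instance

instance : (indToSmallModel C).Faithful := by
  unfold indToSmallModel
  infer_instance

variable [Preadditive C] [HasFiniteColimits C]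

/-- Ind-objects of an essentially small preadditive category with finite colimits form
a preadditive category. -/
noncomputable instance instPreadditiveInd : Preadditive (Ind C) :=
  letI : Preadditive (SmallModel.{v} C) :=
    .ofFullyFaithful (equivSmallModel.{v} C).symm.fullyFaithfulFunctor
  haveI : HasFiniteColimits (SmallModel.{v} C) :=
    ⟨fun _ _ _ => Adjunction.hasColimitsOfShape_of_equivalence (equivSmallModel.{v} C).inverse⟩
  .ofFullyFaithful (.ofFullyFaithful (indToSmallModel C))

end IndPreadditive

section Comod

variable (R : Type u) [CommRing R] [TopologicalSpace R] [IsTopologicalRing R]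

/-- The category of comodules over `R`: ind-objects in the category opposite to the category of
discrete `R`-modules of finite length. -/
abbrev Comod : Type (u + 1) := Ind (FinMod R)ᵒᵖ

namespace Comod

variable {R}

/-- A discrete module of finite length, viewed as a comodule. -/
noncomputable abbrev ofFin : (FinMod R)ᵒᵖ ⥤ Comod R := Ind.yoneda

instance instAdditiveOfFin : (ofFin (R := R)).Additive :=
  have := preservesBinaryBiproducts_of_preservesBinaryCoproducts (ofFin (R := R))
  Functor.additive_of_preservesBinaryBiproducts _

instance instHasLeftKanExtension (F : (FinMod R)ᵒᵖ ⥤ Comod R) :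
    (ofFin (R := R)).HasPointwiseLeftKanExtension F := fun M =>
  have := hasColimitsOfShape_of_essentiallySmall.{u} (CostructuredArrow (ofFin (R := R)) M)
    (Comod R)
  inferInstance

end Comod

end Comod

section Discrete

variable {R : Type u} [CommRing R] [TopologicalSpace R]
variable {A : Type w} [AddCommGroup A] [Module R A]

/-- The sum `∑_x t_x k_x` in a module in which all but finitely many coefficients act by zero. -/
noncomputable def finLin {X : Type v} (t : Lin R X) (k : X → A) : A := ∑ᶠ x, t.1 x • k x

theorem finLin_eq [IsLinearlyComplete R] (I : OpenIdeal R)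
    [Module (R ⧸ I.1) A] [IsScalarTower R (R ⧸ I.1) A] {X : Type v} (t : Lin R X) (k : X → A) :
    finLin t k = Finsupp.linearCombination (R ⧸ I.1) k (Lin.red I t) := by
  have hmk : ∀ (r : R) (a : A), Ideal.Quotient.mk I.1 r • a = r • a := fun r a => by
    rw [← one_smul (R ⧸ I.1) a, ← smul_assoc, ← smul_assoc]
    simp [Algebra.smul_def]
  rw [Finsupp.linearCombination_apply, Finsupp.sum, finLin]
  simp only [Lin.red_apply, hmk]
  refine finsum_eq_sum_of_support_subset _ fun x hx => ?_
  simp only [Finset.mem_coe, Finsupp.mem_support_iff, Lin.red_apply]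
  intro h
  refine hx ?_
  change t.1 x • k x = 0
  rw [← hmk, h, zero_smul]

/-- `A` is annihilated by some open ideal. -/
def IsBounded (R : Type u) [CommRing R] [TopologicalSpace R] (A : Type w) [AddCommGroup A]
    [Module R A] : Prop := ∃ I : OpenIdeal R, ∀ r ∈ I.1, ∀ a : A, r • a = 0

theorem IsBounded.finite_support (hA : IsBounded R A) {X : Type v} (t : Lin R X) (k : X → A) :
    (Function.support fun x => t.1 x • k x).Finite := by
  obtain ⟨I, hI⟩ := hA
  exact (t.2 I).subset fun x hx h => hx (hI _ h _)

variable [IsLinearlyComplete R]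

theorem finLin_unit {X : Type v} (x : X) (k : X → A) : finLin (Lin.unit R x) k = k x := by
  classical
  rw [finLin, finsum_eq_single _ x]
  · simp [Lin.unit]
  · intro y hy
    simp [Lin.unit, hy]

theorem IsBounded.finLin_bind (hA : IsBounded R A) {X : Type v} {Y : Type z} (t : Lin R X)
    (l : X → Lin R Y) (k : Y → A) :
    finLin (Lin.bind t l) k = finLin t fun x => finLin (l x) k := by
  obtain ⟨I, hI⟩ := hA
  have hI' : Module.IsTorsionBySet R A (I.1 : Set R) := fun a r => hI r r.2 a
  let : Module (R ⧸ I.1) A := hI'.module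
  have : IsScalarTower R (R ⧸ I.1) A := hI'.isScalarTower
  simp only [finLin_eq I, Lin.red_bind, Finsupp.apply_linearCombination]
  rfl

theorem IsBounded.finLin_map (hA : IsBounded R A) {X : Type v} {Y : Type z} (t : Lin R X)
    (f : X → Y) (k : Y → A) : finLin (Lin.map f t) k = finLin t fun x => k (f x) := by
  rw [Lin.map, hA.finLin_bind]
  simp only [finLin_unit]

theorem IsBounded.map_finLin (hA : IsBounded R A) {B : Type z} [AddCommGroup B] [Module R B]
    (h : A →ₗ[R] B) {X : Type v} (t : Lin R X) (k : X → A) :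
    h (finLin t k) = finLin t fun x => h (k x) := by
  refine (AddMonoidHom.map_finsum h.toAddMonoidHom (hA.finite_support t k)).trans ?_
  exact finsum_congr fun x => map_smul h _ _

end Discrete

section HomModule

variable {R : Type u} [CommRing R] [TopologicalSpace R]

theorem FinMod.isBounded (X : FinMod R) : IsBounded R X.obj := by
  have := (isFiniteLength_iff_isNoetherian_isArtinian.1 X.property.1).1
  obtain ⟨S, hS⟩ := (inferInstance : Module.Finite R X.obj)
  refine ⟨⟨⨅ s : S, (LinearMap.toSpanSingleton R X.obj s.1).ker, ?_⟩, fun r hr a => ?_⟩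
  · rw [Submodule.coe_iInf]
    exact isOpen_iInter_of_finite fun s => X.property.2 s.1
  · have : a ∈ (LinearMap.lsmul R X.obj r).ker := by
      have h : (⊤ : Submodule R X.obj) ≤ (LinearMap.lsmul R X.obj r).ker := by
        rw [← hS, Submodule.span_le]
        intro s hs
        exact (Submodule.mem_iInf _).1 hr ⟨s, hs⟩
      exact h trivial
    exact this

variable [IsTopologicalRing R]

namespace Comod

/-- The `R`-module structure on the group of morphisms of comodules `X ⟶ N`, where `X` is
a discrete module of finite length: `R` acts through its action on `X`. -/
noncomputable instance instModuleHom (X : FinMod R) (N : Comod R) :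
    Module R (ofFin.obj (op X) ⟶ N) where
  smul r x := ofFin.map (ObjectProperty.homMk (r • 𝟙 X.obj) : X ⟶ X).op ≫ x
  one_smul x := by
    change ofFin.map _ ≫ x = x
    rw [one_smul]
    exact (congrArg (· ≫ x) (ofFin.map_id (op X))).trans (Category.id_comp x)
  mul_smul r s x := by
    change ofFin.map _ ≫ x = ofFin.map _ ≫ ofFin.map _ ≫ x
    rw [← Functor.map_comp_assoc, ← op_comp]
    congr 3
    ext
    simp [mul_smul, smul_comm r]
  smul_zero r := Limits.comp_zero
  smul_add r x y := Preadditive.comp_add _ _ _ _ _ _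
  add_smul r s x := by
    change ofFin.map _ ≫ x = ofFin.map _ ≫ x + ofFin.map _ ≫ x
    rw [← Preadditive.add_comp, ← Functor.map_add, ← op_add]
    congr 3
    ext a
    exact add_smul r s a
  zero_smul x := by
    change ofFin.map _ ≫ x = 0
    have : (ObjectProperty.homMk ((0 : R) • 𝟙 X.obj) : X ⟶ X) = 0 := by
      ext
      simp
    rw [this, op_zero, Functor.map_zero, zero_comp]

theorem smul_def (X : FinMod R) (N : Comod R) (r : R) (x : ofFin.obj (op X) ⟶ N) :
    r • x = ofFin.map (ObjectProperty.homMk (r • 𝟙 X.obj) : X ⟶ X).op ≫ x := rfl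

theorem isBounded_hom (X : FinMod R) (N : Comod R) : IsBounded R (ofFin.obj (op X) ⟶ N) := by
  obtain ⟨I, hI⟩ := X.isBounded
  refine ⟨I, fun r hr x => ?_⟩
  have : (ObjectProperty.homMk (r • 𝟙 X.obj) : X ⟶ X) = 0 := by
    ext a
    exact hI r hr a
  rw [smul_def, this, op_zero, Functor.map_zero, zero_comp]

/-- Precomposition is linear. -/
noncomputable def precomp {X Y : FinMod R} (u : op X ⟶ op Y) (N : Comod R) :
    (ofFin.obj (op Y) ⟶ N) →ₗ[R] (ofFin.obj (op X) ⟶ N) where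
  toFun x := ofFin.map u ≫ x
  map_add' _ _ := Preadditive.comp_add _ _ _ _ _ _
  map_smul' r x := by
    simp only [smul_def, RingHom.id_apply]
    rw [← Functor.map_comp_assoc, ← Functor.map_comp_assoc]
    congr 2
    apply Quiver.Hom.unop_inj
    ext a
    simp

/-- Postcomposition is linear. -/
noncomputable def postcomp (X : FinMod R) {N N' : Comod R} (h : N ⟶ N') :
    (ofFin.obj (op X) ⟶ N) →ₗ[R] (ofFin.obj (op X) ⟶ N') where
  toFun x := x ≫ h
  map_add' _ _ := Preadditive.add_comp _ _ _ _ _ _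
  map_smul' _ _ := Category.assoc _ _ _

theorem hom_ext_ofFin {M N : Comod R} {f g : M ⟶ N}
    (h : ∀ (X : FinMod R) (x : ofFin.obj (op X) ⟶ M), x ≫ f = x ≫ g) : f = g :=
  (existsUnique_ind_hom (fun _ x => x ≫ g) (fun _ _ _ x => Category.assoc _ x g)).unique
    (fun X x => h X.unop x) (fun _ _ => rfl)

end Comod

end HomModule

section HomContra

variable {R : Type u} [CommRing R] [TopologicalSpace R] [IsLinearlyComplete R]

namespace Comod

theorem existsUnique_linComb {M N : Comod R} (t : Lin R (M ⟶ N)) :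
    ∃! g : M ⟶ N, ∀ (X : (FinMod R)ᵒᵖ) (x : ofFin.obj X ⟶ M),
      x ≫ g = finLin t (A := ofFin.obj (op X.unop) ⟶ N) fun f => x ≫ f :=
  existsUnique_ind_hom _ fun X Y u x => by
    refine Eq.trans ?_ ((isBounded_hom Y.unop N).map_finLin (precomp u N) t fun f => x ≫ f).symm
    simp only [Category.assoc]
    rfl

/-- The infinite linear combination `∑_f t_f f` of morphisms of comodules `f : M ⟶ N`. It is the
morphism whose restriction along each `x : X ⟶ M` with `X` of finite length is the finite
linear combination `∑_f t_f (x ≫ f)`. -/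
noncomputable def linComb {M N : Comod R} (t : Lin R (M ⟶ N)) : M ⟶ N :=
  (existsUnique_linComb t).choose

theorem comp_linComb {M N : Comod R} (t : Lin R (M ⟶ N)) {X : FinMod R}
    (x : ofFin.obj (op X) ⟶ M) : x ≫ linComb t = finLin t fun f => x ≫ f :=
  (existsUnique_linComb t).choose_spec.1 (op X) x

theorem linComb_unit {M N : Comod R} (f : M ⟶ N) : linComb (Lin.unit R f) = f :=
  hom_ext_ofFin fun X x => by rw [comp_linComb, finLin_unit]

theorem linComb_join {M N : Comod R} (T : Lin R (Lin R (M ⟶ N))) :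
    linComb (Lin.join T) = linComb (Lin.map linComb T) :=
  hom_ext_ofFin fun X x => by
    rw [comp_linComb, comp_linComb, (isBounded_hom X N).finLin_map, Lin.join,
      (isBounded_hom X N).finLin_bind]
    simp only [comp_linComb]
    rfl

theorem linComb_comp {M N N' : Comod R} (t : Lin R (M ⟶ N)) (h : N ⟶ N') :
    linComb t ≫ h = linComb (Lin.map (fun f : M ⟶ N => f ≫ h) t) :=
  hom_ext_ofFin fun X x => by
    rw [comp_linComb, (isBounded_hom X N').finLin_map, ← Category.assoc, comp_linComb]
    refine ((isBounded_hom X N).map_finLin (postcomp X h) t _).trans ?_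
    exact congrArg (finLin t) (funext fun f => (Category.assoc x f h : (x ≫ f) ≫ h = x ≫ f ≫ h))

/-- The contramodule `Hom_R(M, N)` of morphisms of comodules. -/
noncomputable def homContra (M N : Comod R) : Contra R where
  A := M ⟶ N
  a := ↾linComb
  unit := ConcreteCategory.hom_ext _ _ linComb_unit
  assoc := ConcreteCategory.hom_ext _ _ linComb_join

/-- The functor `Hom_R(M, -)` from comodules to contramodules. -/
noncomputable def homFunctor (M : Comod R) : Comod R ⥤ Contra R where
  obj N := homContra M N
  map {N N'} h := Contra.homMk (P := homContra M N) (Q := homContra M N')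
    (fun f : M ⟶ N => (f ≫ h : M ⟶ N')) fun t => linComb_comp t h
  map_id N := by
    ext f
    exact Category.comp_id _
  map_comp h h' := by
    ext f
    exact (Category.assoc _ _ _).symm

end Comod

end HomContra

section Dual

variable (R : Type u) [CommRing R] [TopologicalSpace R]

/-- The open submodules `U` of a topological module `H` for which `H ⧸ U` is a discrete module of
finite length. -/
abbrev OpenSub (H : Type u) [AddCommGroup H] [Module R H] [TopologicalSpace H] : Type u :=
  {U : Submodule R H // IsOpen (U : Set H) ∧ isFin R (ModuleCat.of R (H ⧸ U))}

variable (H : Type u) [AddCommGroup H] [Module R H] [TopologicalSpace H]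

instance : Nonempty (OpenSub R H) :=
  ⟨⟨⊤, isOpen_univ, .of_subsingleton, fun m => by
    simp [Subsingleton.elim _ (0 : ModuleCat.of R (H ⧸ (⊤ : Submodule R H)))]⟩⟩

theorem OpenSub.exists_le (U V : OpenSub R H) : ∃ W : OpenSub R H, W ≤ U ∧ W ≤ V := by
  refine ⟨⟨U.1 ⊓ V.1, U.2.1.inter V.2.1, ?_⟩, (inf_le_left : U.1 ⊓ V.1 ≤ U.1), (inf_le_right : U.1 ⊓ V.1 ≤ V.1)⟩
  let M : Bool → ModuleCat.{u} R := fun b =>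
    if b then ModuleCat.of R (H ⧸ U.1) else ModuleCat.of R (H ⧸ V.1)
  have hM : ∀ b, isFin R (M b) := fun b => by
    cases b
    · exact V.2.2
    · exact U.2.2
  let f : H →ₗ[R] ∀ b, M b := LinearMap.pi fun b => match b with
    | true => U.1.mkQ
    | false => V.1.mkQ
  have hf : f.ker = U.1 ⊓ V.1 := by
    ext x
    have : f x = 0 ↔ (∀ b, f x b = 0) := funext_iff
    rw [LinearMap.mem_ker, this, Bool.forall_bool, Submodule.mem_inf, and_comm]
    exact and_congr (Submodule.Quotient.mk_eq_zero _) (Submodule.Quotient.mk_eq_zero _)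
  refine isFin_of_injective (N := ModuleCat.of R (∀ b, M b)) ((U.1 ⊓ V.1).liftQ f hf.ge)
    (LinearMap.ker_eq_bot.1 ?_) (isFin_pi M hM)
  exact Submodule.ker_liftQ_eq_bot _ _ _ hf.le

instance : IsFiltered (OpenSub R H)ᵒᵖ :=
  have : IsCodirectedOrder (OpenSub R H) := ⟨OpenSub.exists_le R H⟩
  inferInstance

/-- The projective system of the modules `H ⧸ U`. -/
def quotSystem : OpenSub R H ⥤ FinMod R where
  obj U := ⟨ModuleCat.of R (H ⧸ U.1), U.2.2⟩
  map h := ObjectProperty.homMk (ModuleCat.ofHom (Submodule.factor (leOfHom h)))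
  map_id U := by
    ext x
    rfl
  map_comp f g := by
    ext x
    rfl

/-- The comodule whose opposite is the pro-object given by the projective system of the modules
`H ⧸ U`. It is the inductive limit in ind-objects of the system of the objects `op (H ⧸ U)`. If
`H` is a discrete module of finite length, this is `H` itself, viewed as an object of the opposite
category. -/
noncomputable def dual : Comod R := (Ind.lim (OpenSub R H)ᵒᵖ).obj (quotSystem R H).op

end Dual

section DualMap

variable {R : Type u} [CommRing R] [TopologicalSpace R]
  {H H' H'' : Type u} [AddCommGroup H] [Module R H] [TopologicalSpace H]
  [AddCommGroup H'] [Module R H'] [TopologicalSpace H']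
  [AddCommGroup H''] [Module R H''] [TopologicalSpace H'']

/-- The preimage of an open submodule under a continuous linear map. -/
def OpenSub.comap (φ : H →L[R] H') (U : OpenSub R H') : OpenSub R H :=
  ⟨U.1.comap φ.toLinearMap, U.2.1.preimage φ.continuous,
    isFin_of_injective (M := ModuleCat.of R (H ⧸ U.1.comap φ.toLinearMap))
      (N := ModuleCat.of R (H' ⧸ U.1))
      ((U.1.comap φ.toLinearMap).mapQ U.1 φ.toLinearMap le_rfl)
      (LinearMap.ker_eq_bot.1 (Submodule.ker_liftQ_eq_bot _ _ _ (by
        rw [LinearMap.ker_comp, Submodule.ker_mkQ]))) U.2.2⟩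

/-- The map `H ⧸ φ⁻¹ U ⟶ H' ⧸ U` induced by `φ : H ⟶ H'`. -/
def OpenSub.quotMap (φ : H →L[R] H') (U : OpenSub R H') :
    (quotSystem R H).obj (U.comap φ) ⟶ (quotSystem R H').obj U :=
  ObjectProperty.homMk (ModuleCat.ofHom
    ((U.1.comap φ.toLinearMap).mapQ U.1 φ.toLinearMap le_rfl))

/-- The structure morphism of `dual R H` at `U`. -/
noncomputable def dualι (U : OpenSub R H) :
    Comod.ofFin.obj (op ((quotSystem R H).obj U)) ⟶ dual R H :=
  colimit.ι ((quotSystem R H).op ⋙ Comod.ofFin) (op U)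

theorem dualι_w {U V : OpenSub R H} (h : U ≤ V) :
    Comod.ofFin.map ((quotSystem R H).map (homOfLE h)).op ≫ dualι U = dualι V :=
  colimit.w ((quotSystem R H).op ⋙ Comod.ofFin) (homOfLE h).op

theorem dual_hom_ext {M : Comod R} {f g : dual R H ⟶ M}
    (h : ∀ U : OpenSub R H, dualι U ≫ f = dualι U ≫ g) : f = g :=
  colimit.hom_ext (F := (quotSystem R H).op ⋙ Comod.ofFin) fun U => h U.unop

/-- The morphism of comodules `dual H' ⟶ dual H` induced by a continuous linear map `H → H'`. -/
noncomputable def dualMap (φ : H →L[R] H') : dual R H' ⟶ dual R H :=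
  colimit.desc ((quotSystem R H').op ⋙ Comod.ofFin)
    { pt := dual R H
      ι :=
        { app := fun U => Comod.ofFin.map (OpenSub.quotMap φ U.unop).op ≫
            dualι (OpenSub.comap φ U.unop)
          naturality := fun U V h => by
            have hle : OpenSub.comap φ V.unop ≤ OpenSub.comap φ U.unop :=
              Submodule.comap_mono (leOfHom h.unop)
            dsimp only [Functor.const_obj_obj, Functor.const_obj_map]
            rw [Category.comp_id, ← dualι_w hle]
            dsimp only [Functor.comp_map, Functor.op_map]
            rw [← Functor.map_comp_assoc, ← Functor.map_comp_assoc, ← op_comp, ← op_comp]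
            congr 3
            ext x
            obtain ⟨x, rfl⟩ := Submodule.Quotient.mk_surjective _ x
            rfl } }

theorem dualι_map (φ : H →L[R] H') (U : OpenSub R H') :
    dualι U ≫ dualMap φ =
      Comod.ofFin.map (OpenSub.quotMap φ U).op ≫ dualι (OpenSub.comap φ U) :=
  colimit.ι_desc _ _

theorem dualMap_id : dualMap (ContinuousLinearMap.id R H) = 𝟙 (dual R H) :=
  dual_hom_ext fun U => by
    rw [dualι_map, Category.comp_id]
    have : OpenSub.quotMap (ContinuousLinearMap.id R H) U = 𝟙 _ := by
      ext x
      obtain ⟨x, rfl⟩ := Submodule.Quotient.mk_surjective _ x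
      rfl
    rw [this]
    exact (congrArg (· ≫ dualι U) (Comod.ofFin.map_id _)).trans (Category.id_comp _)

theorem dualMap_comp (φ : H →L[R] H') (ψ : H' →L[R] H'') :
    dualMap (ψ.comp φ) = dualMap ψ ≫ dualMap φ :=
  dual_hom_ext fun U => by
    rw [dualι_map, ← Category.assoc, dualι_map, Category.assoc, dualι_map,
      ← Functor.map_comp_assoc, ← op_comp]
    have : OpenSub.quotMap (ψ.comp φ) U =
        OpenSub.quotMap φ (OpenSub.comap ψ U) ≫ OpenSub.quotMap ψ U := by
      ext x
      obtain ⟨x, rfl⟩ := Submodule.Quotient.mk_surjective _ x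
      rfl
    rw [this]
    rfl

end DualMap

section Contratensor

variable {R : Type u} [CommRing R] [TopologicalSpace R] [IsLinearlyComplete R]

/-- The module `Hom_R(P/IP, N)`, where `N` is a discrete module of finite length and `I` is
an open ideal annihilating `N`. Here `IP` is the image of `I[[P]]` under the contraaction, and
`Hom_R(P/IP, N)` is realized as the module of linear maps `P → N` vanishing on `IP`; it does not
depend on the choice of `I`. -/
noncomputable def redHom (P : Contra R) (N : FinMod R) : Submodule R (P.A →ₗ[R] N.obj) where
  carrier := {h | ∃ I : OpenIdeal R, (∀ r ∈ I.1, ∀ n : N.obj, r • n = 0) ∧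
    ∀ t : Lin R P.A, (∀ p, t.1 p ∈ I.1) → h (P.act t) = 0}
  zero_mem' := by
    obtain ⟨I, hI⟩ := N.isBounded
    exact ⟨I, hI, fun t _ => rfl⟩
  add_mem' := by
    rintro f g ⟨I, hI, hf⟩ ⟨J, hJ, hg⟩
    refine ⟨⟨I.1 ⊓ J.1, I.2.inter J.2⟩, fun r hr => hI r hr.1, fun t ht => ?_⟩
    rw [LinearMap.add_apply, hf t fun p => (ht p).1, hg t fun p => (ht p).2, add_zero]
  smul_mem' := by
    rintro r f ⟨I, hI, hf⟩
    refine ⟨I, hI, fun t ht => ?_⟩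
    rw [LinearMap.smul_apply, hf t ht, smul_zero]

/-- The topology of pointwise convergence, `N` being discrete. -/
noncomputable instance instTopologicalSpaceRedHom (P : Contra R) (N : FinMod R) :
    TopologicalSpace (redHom P N) :=
  TopologicalSpace.induced (fun h p => h.1 p) (@Pi.topologicalSpace P.A (fun _ => N.obj) fun _ => ⊥)

/-- The map `Hom(Q/IQ, N) → Hom(P/I'P, N')` induced by `P ⟶ Q` and `N ⟶ N'`. -/
noncomputable def redHomMap {P Q : Contra R} {N N' : FinMod R} (g : P ⟶ Q) (f : N ⟶ N') :
    redHom Q N →L[R] redHom P N' where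
  toFun h := ⟨f.hom.hom ∘ₗ h.1 ∘ₗ Contra.homLinear g, by
    obtain ⟨I, hI, hh⟩ := h.2
    obtain ⟨J, hJ⟩ := N'.isBounded
    refine ⟨⟨I.1 ⊓ J.1, I.2.inter J.2⟩, fun r hr => hJ r hr.2, fun t ht => ?_⟩
    have : h.1 (Contra.homLinear g (P.act t)) = 0 := by
      refine (congrArg h.1 (Contra.hom_act g t)).trans (hh _ fun q => ?_)
      exact Lin.bind_mem _ _ I (fun p => (ht p).1) q
    exact (congrArg f.hom.hom this).trans (map_zero _)⟩
  map_add' h h' := by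
    ext p
    simp
  map_smul' r h := by
    ext p
    simp
  cont := by
    let : TopologicalSpace N.obj := ⊥
    let : TopologicalSpace N'.obj := ⊥
    have : DiscreteTopology N.obj := ⟨rfl⟩
    refine continuous_induced_rng.2 (continuous_pi fun p => ?_)
    exact (continuous_of_discreteTopology (f := f.hom.hom)).comp
      ((continuous_apply (g.f p)).comp continuous_induced_dom)

theorem redHomMap_id (P : Contra R) (N : FinMod R) :
    redHomMap (𝟙 P) (𝟙 N) = ContinuousLinearMap.id R (redHom P N) := rfl

theorem redHomMap_comp {P Q S : Contra R} {N N' N'' : FinMod R} (g : P ⟶ Q) (g' : Q ⟶ S)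
    (f : N ⟶ N') (f' : N' ⟶ N'') :
    redHomMap (g ≫ g') (f ≫ f') = (redHomMap g f').comp (redHomMap g' f) := rfl

/-- The contratensor product of a contramodule `P` with a comodule `N` of finite length over
a discrete quotient ring `R ⧸ I`. This is the comodule `P/IP ⊙ N` over `R ⧸ I` whose opposite is
`Hom_R(P/IP, N)`, regarded as a pro-object of the category of modules of finite length. The module
`P/IP` is the union of its finitely generated submodules `Q`, and `Hom_R(P/IP, N)` is the projective
limit of the modules of finite length `Hom_R(Q, N)`; the topology of this limit is the topology of
pointwise convergence. -/
noncomputable def contratensorFin : Contra R ⥤ (FinMod R)ᵒᵖ ⥤ Comod R where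
  obj P :=
    { obj := fun N => dual R (redHom P N.unop)
      map := fun f => dualMap (redHomMap (𝟙 P) f.unop)
      map_id := fun N => (congrArg dualMap (redHomMap_id P N.unop)).trans dualMap_id
      map_comp := fun f f' => by
        rw [← dualMap_comp, ← redHomMap_comp, Category.id_comp, unop_comp] }
  map g :=
    { app := fun N => dualMap (redHomMap g (𝟙 N.unop))
      naturality := fun N N' f => by
        dsimp only
        rw [← dualMap_comp, ← dualMap_comp, ← redHomMap_comp, ← redHomMap_comp]
        simp }
  map_id P := by
    ext N
    exact (congrArg dualMap (redHomMap_id P N.unop)).trans dualMap_id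
  map_comp g g' := by
    ext N
    dsimp only [NatTrans.comp_app]
    rw [← dualMap_comp, ← redHomMap_comp, Category.comp_id]

/-- The contratensor product of contramodules and comodules. If a comodule `M` is the inductive
limit of comodules `M_α` of finite length, then `P ⊙ M` is the inductive limit of the comodules
`P ⊙ M_α`. That is, `P ⊙ -` is the left Kan extension of its restriction to the comodules of finite
length: the colimit of `P ⊙ X` over all morphisms `X ⟶ M` with `X` of finite length. -/
noncomputable def contratensor : Contra R ⥤ Comod R ⥤ Comod R :=
  contratensorFin ⋙ Comod.ofFin.lan

variable (R) in
/-- The comodule `C(R)`, whose opposite is the pro-object given by the projective system of the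
modules `R ⧸ I` over the open ideals `I` (with `R ⧸ I` of finite length, which is automatic for
a pro-Artinian ring). -/
noncomputable def Comod.C : Comod R := dual R R

variable (R) in
/-- The functor `Φ_R = C(R) ⊙_R -` from contramodules to comodules. -/
noncomputable def Phi : Contra R ⥤ Comod R := contratensor.flip.obj (Comod.C R)

variable (R) in
/-- The functor `Ψ_R = Hom_R(C(R), -)` from comodules to contramodules. -/
noncomputable def Psi : Comod R ⥤ Contra R := Comod.homFunctor (Comod.C R)

variable (R) in
/-- A comodule is cofree if it is a direct sum of copies of `C(R)`. -/
def isCofree : ObjectProperty (Comod R) := fun M =>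
  ∃ X : Type u, Nonempty (M ≅ ∐ fun _ : X => Comod.C R)

end Contratensor

section Subcategories

variable (R : Type u) [CommRing R] [TopologicalSpace R] [IsLinearlyComplete R]

/-- The category of free contramodules. -/
abbrev FreeContra : Type (u + 1) := (Contra.isFree R).FullSubcategory

/-- The category of cofree comodules. -/
abbrev CofreeComod : Type (u + 1) := (isCofree R).FullSubcategory

end Subcategories

end CoContra

/-! Comodules are studied through linearly topologized modules. An object of finite length is
compact in the ind-category, so morphisms from `N` to `dual R H` are exactly the linear maps `H → N`
that kill an open submodule of finite colength (`toDual_surjective`, `toDual_injective`). Under this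
dictionary a topological power of `T` becomes a direct sum of copies of `dual R T`
(`IsPowerOf.isColimit`), because only finitely many coordinates matter modulo each open submodule.

This is used twice. For `H = R^X` it shows that `dual R (X → R)` is the direct sum of copies of
`C(R)`. A morphism from `C(R)` to it is a compatible family of maps `R^X → R/U`, each depending on
finitely many coordinates; by completeness the coefficients glue to a family in `R` converging to
zero. Hence these morphisms form `R[[X]]` (`linComb_bijective`). The Artinian condition enters here:
each open ideal has finite colength, so it is a stage of `C(R)`. For `H = Hom(R[[X]]/I R[[X]], N)`,
a map is determined by its values on the basis, so `H` is a power of the discrete module `N`, and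
`R[[X]] ⊙ N` is a direct sum of copies of `N`. The Kan extension carries this over to `R[[X]] ⊙ M`
for every comodule `M` (`isColimitContratensorFree`).

An element `p` of `P` defines a morphism `M ⟶ P ⊙ M`, given at finite length by evaluation at `p`.
For `M = C(R)` this is a natural map `P ⟶ Ψ(Φ P)`. If `P` is free, it sends the basis to the
inclusions of the summands of `Φ P`, hence is an isomorphism. Moreover `Ψ` is fully faithful on
cofree comodules: morphisms from a direct sum of copies of `C(R)` to `N`, and from `R[[X]]` to `Ψ
N`, are both families of morphisms `C(R) ⟶ N` indexed by `X`. So `Ψ` is an equivalence and `Φ` is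
its quasi-inverse. Finite biproducts come from the closure of cofree comodules under finite
coproducts, and equivalences preserve products, hence are additive. -/

namespace CoContra

/-! ### Compactness of the objects of `C` in the ind-category -/

section IndCompact

variable {C : Type w} [Category.{v} C]

/-- The Yoneda lemma for ind-objects. -/
noncomputable def indYonedaEquiv (X : C) (M : Ind C) :
    (Ind.yoneda.obj X ⟶ M) ≃ ((Ind.inclusion C).obj M).obj (op X) :=
  ((Ind.inclusion.fullyFaithful (C := C)).homEquiv.trans
    (((Ind.yonedaCompInclusion (C := C)).app X).homCongr (Iso.refl _))).trans yonedaEquiv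

theorem indYonedaEquiv_comp (X : C) {M N : Ind C} (x : Ind.yoneda.obj X ⟶ M) (g : M ⟶ N) :
    indYonedaEquiv X N (x ≫ g) =
      ((Ind.inclusion C).map g).app (op X) (indYonedaEquiv X M x) := by
  simp only [indYonedaEquiv, Equiv.trans_apply, Functor.FullyFaithful.homEquiv_apply,
    Functor.map_comp, Iso.homCongr_apply, Iso.refl_hom, Category.comp_id, Iso.app_inv]
  rw [← yonedaEquiv_comp, Category.assoc]

/-- The functor represented by an object of `C` on ind-objects is an evaluation functor. -/
noncomputable def coyonedaIndYonedaIso (X : C) :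
    coyoneda.obj (op (Ind.yoneda.obj X)) ≅
      Ind.inclusion C ⋙ (evaluation Cᵒᵖ (Type v)).obj (op X) :=
  NatIso.ofComponents (fun M => (indYonedaEquiv X M).toIso) fun g =>
    ConcreteCategory.hom_ext _ _ fun x => indYonedaEquiv_comp X x g

/-- Filtered colimits of ind-objects are computed in presheaves, and evaluation at `X` preserves
them. -/
instance preservesColimitsOfShape_coyoneda_indYoneda (X : C) (J : Type v) [SmallCategory J]
    [IsFiltered J] : PreservesColimitsOfShape J (coyoneda.obj (op (Ind.yoneda.obj X))) :=
  preservesColimitsOfShape_of_natIso (coyonedaIndYonedaIso X).symm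

end IndCompact

/-! ### Morphisms into `dual R H` as continuous linear maps -/

section DualHom

variable {R : Type u} [CommRing R] [TopologicalSpace R]
  {H : Type u} [AddCommGroup H] [Module R H] [TopologicalSpace H]

/-- By compactness `x` factors through one stage of the filtered colimit, and fullness of the
embedding turns the factor into a module map. -/
theorem exists_fac_dualι {N : FinMod R} (x : Comod.ofFin.obj (op N) ⟶ dual R H) :
    ∃ (U : OpenSub R H) (f : (quotSystem R H).obj U ⟶ N), x = Comod.ofFin.map f.op ≫ dualι U := by
  have hc := isColimitOfPreserves (coyoneda.obj (op (Comod.ofFin.obj (op N))))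
    (colimit.isColimit ((quotSystem R H).op ⋙ Comod.ofFin))
  obtain ⟨U, y, hy⟩ := Types.jointly_surjective_of_isColimit hc x
  obtain ⟨f, hf⟩ := Comod.ofFin.map_surjective (X := op N)
    (Y := op ((quotSystem R H).obj U.unop)) y
  refine ⟨U.unop, f.unop, ?_⟩
  rw [Quiver.Hom.op_unop, hf]
  exact hy.symm

/-- Two elements at one stage of a filtered colimit of sets are identified only if they agree at a
later stage, here on the quotient by a smaller submodule. -/
theorem exists_eq_of_comp_dualι_eq {N : FinMod R} {U : OpenSub R H}
    (f g : (quotSystem R H).obj U ⟶ N)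
    (h : Comod.ofFin.map f.op ≫ dualι U = Comod.ofFin.map g.op ≫ dualι U) :
    ∃ (V : OpenSub R H) (hV : V ≤ U),
      (quotSystem R H).map (homOfLE hV) ≫ f = (quotSystem R H).map (homOfLE hV) ≫ g := by
  have hc := isColimitOfPreserves (coyoneda.obj (op (Comod.ofFin.obj (op N))))
    (colimit.isColimit ((quotSystem R H).op ⋙ Comod.ofFin))
  obtain ⟨V, k, hk⟩ := (Types.FilteredColimit.isColimit_eq_iff' hc (i := op U)
    (Comod.ofFin.map f.op) (Comod.ofFin.map g.op)).1 h
  refine ⟨V.unop, leOfHom k.unop, ?_⟩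
  apply Quiver.Hom.op_inj
  apply Comod.ofFin.map_injective
  rw [op_comp, op_comp, Functor.map_comp, Functor.map_comp]
  exact hk

/-- The linear maps from a topological module to a discrete module of finite length that vanish on
an open submodule of finite colength. -/
def contHom (R : Type u) [CommRing R] [TopologicalSpace R] (H : Type u) [AddCommGroup H]
    [Module R H] [TopologicalSpace H] (N : FinMod R) : Submodule R (H →ₗ[R] N.obj) where
  carrier := {f | ∃ W : OpenSub R H, W.1 ≤ LinearMap.ker f}
  zero_mem' := ⟨Classical.arbitrary _, fun _ _ => rfl⟩
  add_mem' := by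
    rintro f g ⟨U, hU⟩ ⟨V, hV⟩
    obtain ⟨W, hWU, hWV⟩ := OpenSub.exists_le R H U V
    refine ⟨W, fun x hx => ?_⟩
    have h1 : f x = 0 := hU (hWU hx)
    have h2 : g x = 0 := hV (hWV hx)
    rw [LinearMap.mem_ker, LinearMap.add_apply, h1, h2, add_zero]
  smul_mem' := by
    rintro r f ⟨U, hU⟩
    refine ⟨U, fun x hx => ?_⟩
    have h1 : f x = 0 := hU hx
    rw [LinearMap.mem_ker, LinearMap.smul_apply, h1, smul_zero]

/-- A linear map into a discrete module of finite length whose kernel is open. -/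
theorem mem_contHom_of_isOpen {N : FinMod R} (f : H →ₗ[R] N.obj)
    (hf : IsOpen (LinearMap.ker f : Set H)) : f ∈ contHom R H N :=
  ⟨⟨LinearMap.ker f, hf, isFin_of_injective (M := ModuleCat.of R (H ⧸ LinearMap.ker f))
    (N := N.obj) ((LinearMap.ker f).liftQ f le_rfl)
    (LinearMap.ker_eq_bot.1 (Submodule.ker_liftQ_eq_bot _ _ _ le_rfl)) N.property⟩, le_rfl⟩

/-- The map induced on the quotient by an open submodule. -/
def OpenSub.desc {N : FinMod R} (W : OpenSub R H) (f : H →ₗ[R] N.obj)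
    (hf : W.1 ≤ LinearMap.ker f) : (quotSystem R H).obj W ⟶ N :=
  ObjectProperty.homMk (ModuleCat.ofHom (W.1.liftQ f hf))

theorem OpenSub.hom_ext {N : FinMod R} {W : OpenSub R H} {f g : (quotSystem R H).obj W ⟶ N}
    (h : ∀ x : H, f.hom.hom (W.1.mkQ x) = g.hom.hom (W.1.mkQ x)) : f = g := by
  ext x
  obtain ⟨x, rfl⟩ := Submodule.Quotient.mk_surjective _ x
  exact h x

/-- The morphism of comodules corresponding to a linear map that vanishes on an open submodule. -/
noncomputable def toDual {N : FinMod R} (f : contHom R H N) :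
    Comod.ofFin.obj (op N) ⟶ dual R H :=
  Comod.ofFin.map (OpenSub.desc f.2.choose f.1 f.2.choose_spec).op ≫ dualι f.2.choose

/-- The definition of `toDual` chooses a submodule inside the kernel. Two choices are compared on a
common smaller one, so any convenient `W` may be used. -/
theorem toDual_eq {N : FinMod R} (f : contHom R H N) (W : OpenSub R H)
    (hW : W.1 ≤ LinearMap.ker f.1) :
    toDual f = Comod.ofFin.map (OpenSub.desc W f.1 hW).op ≫ dualι W := by
  obtain ⟨V, h1, h2⟩ := OpenSub.exists_le R H f.2.choose W
  rw [toDual, ← dualι_w h1, ← dualι_w h2, ← Functor.map_comp_assoc, ← Functor.map_comp_assoc,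
    ← op_comp, ← op_comp]
  congr 3
  exact OpenSub.hom_ext fun _ => rfl

theorem comp_toDual {N N' : FinMod R} (u : N ⟶ N') (f : contHom R H N) (g : contHom R H N')
    (h : g.1 = u.hom.hom ∘ₗ f.1) :
    Comod.ofFin.map u.op ≫ toDual f = toDual g := by
  obtain ⟨W, hW⟩ := f.2
  have hW' : W.1 ≤ LinearMap.ker g.1 := fun x hx => by
    have h1 : f.1 x = 0 := hW hx
    rw [LinearMap.mem_ker, h, LinearMap.comp_apply, h1, map_zero]
  rw [toDual_eq f W hW, toDual_eq g W hW', ← Functor.map_comp_assoc, ← op_comp]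
  congr 3
  refine OpenSub.hom_ext fun x => ?_
  exact (LinearMap.congr_fun h x).symm

theorem toDual_surjective {N : FinMod R} :
    Function.Surjective (toDual : contHom R H N → _) := fun x => by
  obtain ⟨U, f, rfl⟩ := exists_fac_dualι x
  have hU : U.1 ≤ LinearMap.ker (f.hom.hom ∘ₗ U.1.mkQ) := fun x hx => by
    have : U.1.mkQ x = 0 := (Submodule.Quotient.mk_eq_zero _).2 hx
    exact (congrArg f.hom.hom this).trans (map_zero _)
  refine ⟨⟨f.hom.hom ∘ₗ U.1.mkQ, U, hU⟩, ?_⟩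
  rw [toDual_eq _ U hU]
  congr 3
  exact OpenSub.hom_ext fun _ => rfl

theorem toDual_injective {N : FinMod R} :
    Function.Injective (toDual : contHom R H N → _) := fun f g h => by
  obtain ⟨U, hU⟩ := f.2
  obtain ⟨V, hV⟩ := g.2
  obtain ⟨W, h1, h2⟩ := OpenSub.exists_le R H U V
  rw [toDual_eq f W (le_trans h1 hU), toDual_eq g W (le_trans h2 hV)] at h
  obtain ⟨V', hV', h'⟩ := exists_eq_of_comp_dualι_eq _ _ h
  refine Subtype.ext (LinearMap.ext fun x => ?_)
  -- The projection to `H ⧸ V'` followed by the map to `H ⧸ W` is the projection to `H ⧸ W` by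
  -- definition, so this equation is `f x = g x`.
  have := congrArg (fun k : (quotSystem R H).obj V' ⟶ N => k.hom.hom (V'.1.mkQ x)) h'
  exact this

/-- `dualι U` corresponds to the projection onto the quotient by `U`. -/
def OpenSub.proj (U : OpenSub R H) : contHom R H ((quotSystem R H).obj U) :=
  ⟨U.1.mkQ, U, (Submodule.ker_mkQ _).ge⟩

theorem toDual_proj (U : OpenSub R H) : toDual U.proj = dualι U := by
  rw [toDual_eq U.proj U (Submodule.ker_mkQ _).ge]
  have : OpenSub.desc U U.proj.1 (Submodule.ker_mkQ _).ge = 𝟙 _ := OpenSub.hom_ext fun _ => rfl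
  rw [this]
  exact (congrArg (· ≫ dualι U) (Comod.ofFin.map_id _)).trans (Category.id_comp _)

variable {H' : Type u} [AddCommGroup H'] [Module R H'] [TopologicalSpace H']

/-- `dualMap φ` acts as precomposition with `φ`. This reduces identities between comodule morphisms
to identities between linear maps. -/
theorem toDual_dualMap {N : FinMod R} (f : contHom R H' N) (φ : H →L[R] H') (g : contHom R H N)
    (h : g.1 = f.1 ∘ₗ φ.toLinearMap) : toDual f ≫ dualMap φ = toDual g := by
  obtain ⟨W, hW⟩ := f.2
  have hW' : (W.comap φ).1 ≤ LinearMap.ker g.1 := fun x hx => by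
    have h1 : f.1 (φ x) = 0 := hW hx
    rw [LinearMap.mem_ker, h]
    exact h1
  rw [toDual_eq f W hW, toDual_eq g _ hW', Category.assoc, dualι_map, ← Functor.map_comp_assoc,
    ← op_comp]
  congr 3
  refine OpenSub.hom_ext fun x => ?_
  exact (LinearMap.congr_fun h x).symm

variable [IsTopologicalRing R]

variable (R H) in
/-- Morphisms from a comodule of finite length into `dual R H`. -/
noncomputable def toDualLinear (N : FinMod R) :
    contHom R H N →ₗ[R] (Comod.ofFin.obj (op N) ⟶ dual R H) where
  toFun := toDual
  map_add' f g := by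
    obtain ⟨U, hU⟩ := f.2
    obtain ⟨V, hV⟩ := g.2
    obtain ⟨W, h1, h2⟩ := OpenSub.exists_le R H U V
    have hf : W.1 ≤ LinearMap.ker f.1 := le_trans h1 hU
    have hg : W.1 ≤ LinearMap.ker g.1 := le_trans h2 hV
    have hfg : W.1 ≤ LinearMap.ker (f + g).1 := fun x hx => by
      have e1 : f.1 x = 0 := hf hx
      have e2 : g.1 x = 0 := hg hx
      change f.1 x + g.1 x = 0
      rw [e1, e2, add_zero]
    rw [toDual_eq f W hf, toDual_eq g W hg, toDual_eq _ W hfg, ← Preadditive.add_comp,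
      ← Functor.map_add, ← op_add]
    congr 3
    exact OpenSub.hom_ext fun _ => rfl
  map_smul' r f := by
    rw [RingHom.id_apply, Comod.smul_def]
    refine (comp_toDual _ _ _ ?_).symm
    rfl

end DualHom

end CoContra

namespace CoContra

/-! ### Topological powers dualize to direct sums -/

section DualCoproduct

variable {R : Type u} [CommRing R] [TopologicalSpace R] [IsTopologicalRing R]
  {T H : Type u} [AddCommGroup T] [Module R T] [TopologicalSpace T]
  [AddCommGroup H] [Module R H] [TopologicalSpace H]

/-- The continuous linear maps `π` and `σ` exhibit `H` as a topological product of copies of `T`,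
as far as its open submodules of finite colength are concerned. -/
structure IsPowerOf {X : Type v} (π : X → H →L[R] T) (σ : X → T →L[R] H) : Prop where
  proj_incl : ∀ x a, π x (σ x a) = a
  proj_incl_of_ne : ∀ x y, x ≠ y → ∀ a, π y (σ x a) = 0
  exists_finset : ∀ U : OpenSub R H, ∃ F : Finset X, (∀ x ∉ F, ∀ a, σ x a ∈ U.1) ∧
    ∀ h, h - ∑ x ∈ F, σ x (π x h) ∈ U.1

/-- The restriction of `dualMap φ` along a structure morphism vanishes if `φ` takes values in the
submodule. -/
theorem dualι_dualMap_eq_zero (φ : T →L[R] H) (U : OpenSub R H) (h : ∀ a, φ a ∈ U.1) :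
    dualι U ≫ dualMap φ = 0 := by
  rw [← toDual_proj]
  refine (toDual_dualMap _ φ 0 ?_).trans (map_zero (toDualLinear R T _))
  refine LinearMap.ext fun a => ?_
  exact ((Submodule.Quotient.mk_eq_zero _).2 (h a)).symm

theorem dualMap_zero : dualMap (0 : T →L[R] H) = 0 :=
  dual_hom_ext fun U => by
    rw [dualι_dualMap_eq_zero _ _ fun _ => U.1.zero_mem, comp_zero]

/-- `dualι U` decomposes into a sum if the identity of `H` does so modulo `U`. -/
theorem dualι_eq_sum {X : Type v} (F : Finset X) (φ : X → H →L[R] H) (U : OpenSub R H)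
    (h : ∀ a, a - ∑ x ∈ F, φ x a ∈ U.1) :
    dualι U = ∑ x ∈ F, dualι U ≫ dualMap (φ x) := by
  let g : X → contHom R H ((quotSystem R H).obj U) := fun x =>
    ⟨U.1.mkQ ∘ₗ (φ x).toLinearMap, U.comap (φ x), fun a ha =>
      (Submodule.Quotient.mk_eq_zero _).2 ha⟩
  have hg : ∀ x, dualι U ≫ dualMap (φ x) = toDualLinear R H _ (g x) := fun x => by
    rw [← toDual_proj]
    exact toDual_dualMap _ _ _ rfl
  have : U.proj = ∑ x ∈ F, g x := by
    refine Subtype.ext (LinearMap.ext fun a => ?_)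
    rw [AddSubmonoidClass.coe_finsetSum, LinearMap.sum_apply]
    have h1 := (Submodule.Quotient.eq _).2 (h a)
    refine h1.trans ?_
    exact map_sum U.1.mkQ _ _
  rw [Finset.sum_congr rfl fun x _ => hg x, ← map_sum, ← this]
  exact (toDual_proj U).symm

namespace IsPowerOf

variable {X : Type v} {π : X → H →L[R] T} {σ : X → T →L[R] H} (hp : IsPowerOf π σ)
include hp

/-- Almost all `σ x` take values in `U`, so their terms vanish; this makes the sum defining `desc`
finite. -/
theorem finite_support {M : Comod R} (m : X → (dual R T ⟶ M)) (U : OpenSub R H) :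
    (Function.support fun x => dualι U ≫ dualMap (σ x) ≫ m x).Finite := by
  obtain ⟨F, hF, -⟩ := hp.exists_finset U
  refine F.finite_toSet.subset fun x hx => ?_
  by_contra h
  refine hx ?_
  change dualι U ≫ dualMap (σ x) ≫ m x = 0
  rw [← Category.assoc, dualι_dualMap_eq_zero _ _ (hF x h), zero_comp]

/-- The morphism out of `dual R H` with given components. -/
noncomputable def desc {M : Comod R} (m : X → (dual R T ⟶ M)) : dual R H ⟶ M :=
  colimit.desc ((quotSystem R H).op ⋙ Comod.ofFin)
    { pt := M
      ι :=
        { app := fun U => ∑ᶠ x, dualι U.unop ≫ dualMap (σ x) ≫ m x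
          naturality := fun U V k => by
            have := (Preadditive.leftComp M (Comod.ofFin.map ((quotSystem R H).map k.unop).op)
              ).map_finsum (f := fun x => dualι V.unop ≫ dualMap (σ x) ≫ m x)
              (hp.finite_support m V.unop)
            refine this.trans ((finsum_congr fun x => ?_).trans (Category.comp_id _).symm)
            have h := dualι_w (leOfHom k.unop)
            exact (Category.assoc _ _ _).symm.trans (congrArg (· ≫ dualMap (σ x) ≫ m x) h) } }

theorem dualι_desc {M : Comod R} (m : X → (dual R T ⟶ M)) (U : OpenSub R H) :
    dualι U ≫ hp.desc m = ∑ᶠ x, dualι U ≫ dualMap (σ x) ≫ m x :=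
  colimit.ι_desc _ _

/-- At each stage the sum collapses: `π y ∘ σ x` is zero for `x ≠ y` and the identity for `x = y`.
-/
theorem dualMap_desc {M : Comod R} (m : X → (dual R T ⟶ M)) (y : X) :
    dualMap (π y) ≫ hp.desc m = m y := by
  refine dual_hom_ext fun U => ?_
  rw [← Category.assoc, dualι_map, Category.assoc, hp.dualι_desc]
  refine ((Preadditive.leftComp M (Comod.ofFin.map (OpenSub.quotMap (π y) U).op)
    ).map_finsum (f := fun x => dualι (U.comap (π y)) ≫ dualMap (σ x) ≫ m x)
    (hp.finite_support m _)).trans ?_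
  have key : ∀ x, Preadditive.leftComp M (Comod.ofFin.map (OpenSub.quotMap (π y) U).op)
      (dualι (U.comap (π y)) ≫ dualMap (σ x) ≫ m x) =
      dualι U ≫ dualMap ((π y).comp (σ x)) ≫ m x := fun x => by
    rw [dualMap_comp, Category.assoc, ← Category.assoc (dualι U), dualι_map, Category.assoc]
    rfl
  rw [finsum_congr key, finsum_eq_single _ y]
  · have : (π y).comp (σ y) = ContinuousLinearMap.id R T :=
      ContinuousLinearMap.ext (hp.proj_incl y)
    rw [this, dualMap_id, Category.id_comp]
  · intro x hx
    have : (π y).comp (σ x) = 0 := ContinuousLinearMap.ext (hp.proj_incl_of_ne x y hx)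
    rw [this, dualMap_zero, zero_comp, comp_zero]

/-- Modulo `U` the identity of `H` is a finite sum of the `σ x ∘ π x`, so each `dualι U` is a finite
sum of morphisms factoring through the `dualMap (π x)`. -/
theorem hom_ext {M : Comod R} {g g' : dual R H ⟶ M}
    (h : ∀ x, dualMap (π x) ≫ g = dualMap (π x) ≫ g') : g = g' :=
  dual_hom_ext fun U => by
    obtain ⟨F, -, hF⟩ := hp.exists_finset U
    rw [dualι_eq_sum F (fun x => (σ x).comp (π x)) U hF, Preadditive.sum_comp,
      Preadditive.sum_comp]
    refine Finset.sum_congr rfl fun x _ => ?_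
    simp only [dualMap_comp, Category.assoc, h]

/-- `dual R H` is the direct sum of copies of `dual R T`. -/
noncomputable def isColimit :
    IsColimit (Cofan.mk (dual R H) fun x => dualMap (π x)) :=
  Cofan.IsColimit.mk _ (fun s => hp.desc s.inj) (fun s => hp.dualMap_desc s.inj)
    (fun s _ hm => hp.hom_ext fun x => (hm x).trans (hp.dualMap_desc s.inj x).symm)

end IsPowerOf

end DualCoproduct

end CoContra

namespace CoContra

/-! ### Finite linear combinations and free contramodules -/

section FinLin

variable {R : Type u} [CommRing R] [TopologicalSpace R]

theorem finLin_eq_sum {A : Type w} [AddCommGroup A] [Module R A] {X : Type v} (t : Lin R X)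
    (k : X → A) (F : Finset X) (h : ∀ x ∉ F, t.1 x • k x = 0) :
    finLin t k = ∑ x ∈ F, t.1 x • k x :=
  finsum_eq_sum_of_support_subset _ fun x hx => by
    by_contra hxF
    exact hx (h x hxF)

theorem isBounded_contHom (H : Type u) [AddCommGroup H] [Module R H] [TopologicalSpace H]
    (N : FinMod R) : IsBounded R (contHom R H N) := by
  obtain ⟨I, hI⟩ := N.isBounded
  exact ⟨I, fun r hr f => Subtype.ext (LinearMap.ext fun a => hI r hr _)⟩

variable [IsLinearlyComplete R]

theorem finLin_contHom_apply {H : Type u} [AddCommGroup H] [Module R H] [TopologicalSpace H]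
    {N : FinMod R} {X : Type v} (t : Lin R X) (k : X → contHom R H N) (a : H) :
    (finLin t k).1 a = finLin t fun x => (k x).1 a :=
  (isBounded_contHom H N).map_finLin (LinearMap.applyₗ a ∘ₗ (contHom R H N).subtype) t k

end FinLin

namespace Contra

variable {R : Type u} [CommRing R] [TopologicalSpace R] [IsLinearlyComplete R]

/-- The morphism from a free contramodule extending a map of sets. -/
noncomputable def freeLift {X : Type u} {K : Contra R} (k : X → K.A) : free R X ⟶ K :=
  homMk (P := free R X) (fun t : Lin R X => K.act (Lin.map k t)) fun T => by
    have h := K.act_bind (X := Lin R X) T fun t => Lin.map k t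
    refine Eq.trans ?_ h
    refine congrArg K.act ?_
    exact Lin.bind_bind T id _

theorem freeLift_apply {X : Type u} {K : Contra R} (k : X → K.A) (t : Lin R X) :
    (freeLift k).f t = K.act (Lin.map k t) := rfl

theorem freeLift_unit {X : Type u} {K : Contra R} (k : X → K.A) (x : X) :
    (freeLift k).f (Lin.unit R x) = k x := by
  rw [freeLift_apply, Lin.map, Lin.unit_bind, act_unit]

theorem free_act_map_unit {X : Type u} (t : Lin R X) :
    (free R X).act (Lin.map (Lin.unit R) t) = t := by
  refine (Lin.bind_bind t _ _).trans ?_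
  refine (congrArg (Lin.bind t) (funext fun x => Lin.unit_bind _ _)).trans ?_
  exact Lin.bind_unit t

/-- Each `t` is the linear combination of the basis elements with its own coefficients, and
morphisms commute with infinite linear combinations. -/
theorem free_hom_ext {X : Type u} {K : Contra R} {f g : free R X ⟶ K}
    (h : ∀ x, f.f (Lin.unit R x) = g.f (Lin.unit R x)) : f = g := by
  have key : ∀ (f : free R X ⟶ K) (t : Lin R X),
      f.f t = K.act (Lin.map (fun x => f.f (Lin.unit R x)) t) := fun f t => by
    have e := hom_act f (Lin.map (Lin.unit R) t)
    refine (congrArg f.f (free_act_map_unit t)).symm.trans (e.trans (congrArg K.act ?_))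
    refine (Lin.bind_bind t _ _).trans ?_
    exact congrArg (Lin.bind t) (funext fun x => Lin.unit_bind _ _)
  ext t
  refine (key f t).trans (Eq.trans ?_ (key g t).symm)
  simp only [h]

theorem isIso_of_bijective {P Q : Contra R} (f : P ⟶ Q) (hf : Function.Bijective f.f) :
    IsIso f :=
  have : IsIso f.f := (isIso_iff_bijective f.f).2 hf
  Monad.algebra_iso_of_iso _ f

end Contra

/-! ### Morphisms from `C(R)` to a direct sum of copies of `C(R)` -/

section HomCofree

variable {R : Type u} [CommRing R] [TopologicalSpace R]

theorem isPowerOf_pi [IsTopologicalRing R] (X : Type u) [DecidableEq X] :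
    IsPowerOf (R := R) (T := R) (H := X → R) (fun x => ContinuousLinearMap.proj x)
      (fun x => ContinuousLinearMap.single R (fun _ : X => R) x) where
  proj_incl x a := by simp
  proj_incl_of_ne x y h a := by simp [h.symm]
  exists_finset U := by
    -- A neighborhood of zero in the product topology constrains only the finitely many coordinates
    -- in `F`.
    obtain ⟨F, u, hu, hF⟩ := isOpen_pi_iff.1 U.2.1 0 U.1.zero_mem
    have key : ∀ h : X → R, (∀ x ∈ F, h x = 0) → h ∈ U.1 := fun h hh =>
      hF fun x hx => by
        rw [hh x hx]
        exact (hu x hx).2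
    refine ⟨F, fun x hx a => key _ fun y hy => ?_, fun h => key _ fun y hy => ?_⟩
    · have : y ≠ x := fun e => hx (e ▸ hy)
      simp [this]
    · simp [Finset.sum_apply, Pi.single_apply, hy]

/-- An open ideal of a pro-Artinian ring, as an open submodule of finite colength. -/
def openSubOfIdeal [IsProArtinian R] (I : OpenIdeal R) : OpenSub R R :=
  ⟨I.1, I.2, by
    have := IsProArtinian.isArtinianRing_quotient I
    refine ⟨?_, fun m => ?_⟩
    · have hs : Function.Surjective (algebraMap R (R ⧸ I.1)) := Ideal.Quotient.mk_surjective
      refine isFiniteLength_iff_isNoetherian_isArtinian.2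
        ⟨⟨fun N => ?_⟩, isArtinian_of_surjective_algebraMap hs⟩
      -- An `R`-submodule of `R ⧸ I` is an ideal of this quotient ring, which is Noetherian because
      -- it is Artinian.
      let N' : Ideal (R ⧸ I.1) :=
        { N.toAddSubmonoid with
          smul_mem' := fun c x hx => by
            obtain ⟨r, rfl⟩ := hs c
            rw [algebraMap_smul]
            exact N.smul_mem r hx }
      exact Submodule.FG.restrictScalars_of_surjective (S := N')
        (IsNoetherian.noetherian N') hs
    · obtain ⟨a, rfl⟩ := Ideal.Quotient.mk_surjective m
      refine AddSubgroup.isOpen_mono (H₁ := I.1.toAddSubgroup)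
        (H₂ := (LinearMap.ker (LinearMap.toSpanSingleton R (R ⧸ I.1)
          (Ideal.Quotient.mk I.1 a))).toAddSubgroup) (fun r hr => ?_) I.2
      change r • Ideal.Quotient.mk I.1 a = 0
      exact Ideal.Quotient.eq_zero_iff_mem.2 (I.1.mul_mem_right a hr)⟩

variable [IsLinearlyComplete R]

namespace Comod

theorem comp_linComb_map {M N : Comod R} {Y : Type u} (j : Y → (M ⟶ N)) (t : Lin R Y)
    {X : FinMod R} (x : ofFin.obj (op X) ⟶ M) :
    x ≫ linComb (Lin.map j t) = finLin t fun y => x ≫ j y := by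
  rw [comp_linComb, (isBounded_hom X N).finLin_map]

end Comod

/-- The coordinates of `R ^ X` modulo an open submodule of `R`. -/
def coordMod {X : Type u} (U : OpenSub R R) (x : X) :
    contHom R (X → R) ((quotSystem R R).obj U) :=
  ⟨U.1.mkQ ∘ₗ LinearMap.proj x, U.comap (ContinuousLinearMap.proj x), fun _ ha =>
      (Submodule.Quotient.mk_eq_zero _).2 ha⟩

/-- At the stage `U` the infinite combination of the inclusions becomes the map `a ↦ ∑ t_x a_x`
modulo `U`, a finite sum. -/
theorem dualι_linComb_proj {X : Type u} (t : Lin R X) (U : OpenSub R R) :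
    dualι U ≫ Comod.linComb (Lin.map
      (fun x : X => dualMap (ContinuousLinearMap.proj (R := R) (φ := fun _ : X => R) x)) t) =
      toDual (finLin t (coordMod U)) := by
  have h : ∀ x : X, dualι U ≫ dualMap (ContinuousLinearMap.proj (R := R) (φ := fun _ : X => R) x) =
      toDualLinear R (X → R) _ (coordMod U x) := fun x => by
    rw [← toDual_proj]
    exact toDual_dualMap _ _ _ rfl
  rw [Comod.comp_linComb_map]
  simp only [h]
  exact ((isBounded_contHom _ _).map_finLin (toDualLinear R (X → R) _) t _).symm

theorem finLin_coordMod_single {X : Type u} [DecidableEq X] (t : Lin R X) (U : OpenSub R R)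
    (y : X) : (finLin t (coordMod U)).1 (Pi.single y 1) = U.1.mkQ (t.1 y) := by
  rw [finLin_contHom_apply, finLin, finsum_eq_single _ y]
  · change t.1 y • U.1.mkQ ((Pi.single y 1 : X → R) y) = _
    rw [Pi.single_eq_same, ← map_smul, smul_eq_mul, mul_one]
  · intro x hx
    change t.1 x • U.1.mkQ ((Pi.single y 1 : X → R) x) = _
    rw [Pi.single_eq_of_ne hx, map_zero, smul_zero]
    rfl

end HomCofree

/-! ### Identification of these morphisms with `R[[X]]` -/

section HomCofreeBijective

variable {R : Type u} [CommRing R] [TopologicalSpace R] [IsProArtinian R]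

theorem linComb_proj_injective (X : Type u) : Function.Injective fun t : Lin R X =>
    Comod.linComb (Lin.map
      (fun x : X => dualMap (ContinuousLinearMap.proj (R := R) (φ := fun _ : X => R) x)) t) := by
  classical
  intro t t' h
  refine Subtype.ext (funext fun x => eq_of_forall_sub_mem fun I => ?_)
  -- As `R ⧸ I` has finite length, `I` is a stage of `C(R)`. Evaluating there at the basis vector of
  -- index `x` reads off `t x` modulo `I`.
  have hI := congrArg (dualι (openSubOfIdeal I) ≫ ·) h
  dsimp only at hI
  rw [dualι_linComb_proj, dualι_linComb_proj] at hI
  have := LinearMap.congr_fun (congrArg Subtype.val (toDual_injective hI)) (Pi.single x 1)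
  rw [finLin_coordMod_single, finLin_coordMod_single] at this
  exact (Submodule.Quotient.eq _).1 this

theorem linComb_proj_surjective (X : Type u) : Function.Surjective fun t : Lin R X =>
    Comod.linComb (Lin.map
      (fun x : X => dualMap (ContinuousLinearMap.proj (R := R) (φ := fun _ : X => R) x)) t) := by
  classical
  intro g
  -- `f U : R^X → R ⧸ U` is the linear map corresponding to the restriction of `g` to the stage `U`.
  choose f hf using fun U : OpenSub R R => toDual_surjective (dualι U ≫ g)
  have hmap : ∀ {U V : OpenSub R R} (h : U ≤ V) (a : X → R),
      (f V).1 a = ((quotSystem R R).map (homOfLE h)).hom.hom ((f U).1 a) := by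
    intro U V h
    let f' : contHom R (X → R) ((quotSystem R R).obj V) :=
      ⟨((quotSystem R R).map (homOfLE h)).hom.hom ∘ₗ (f U).1, (f U).2.choose, fun a ha => by
        have h0 : (f U).1 a = 0 := (f U).2.choose_spec ha
        exact (congrArg _ h0).trans (map_zero _)⟩
    have : f V = f' := toDual_injective <| by
      rw [hf, ← comp_toDual ((quotSystem R R).map (homOfLE h)) (f U) f' rfl, hf,
        ← Category.assoc, dualι_w]
    exact fun a => LinearMap.congr_fun (congrArg Subtype.val this) a
  -- The values of the `f U` on a basis vector are compatible by `hmap`, so completeness glues them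
  -- to a coefficient `t x` in `R`.
  choose t ht using fun x : X => (IsLinearlyComplete.bijective_toQuotLim (R := R)).2
    ⟨fun I => (f (openSubOfIdeal I)).1 (Pi.single x 1), fun I J h =>
      (hmap (U := openSubOfIdeal I) (V := openSubOfIdeal J) h (Pi.single x 1)).symm⟩
  have ht' : ∀ (U : OpenSub R R) (x : X), (f U).1 (Pi.single x 1) = U.1.mkQ (t x) := fun U x =>
    (congrFun (congrArg Subtype.val (ht x)) ⟨U.1, U.2.1⟩).symm
  -- The kernel of `f U` contains an open submodule, so `f U` depends only on the coordinates in a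
  -- finite set `F`. Outside `F` the basis vectors are killed, which puts `t x` into `U`.
  have hfin : ∀ U : OpenSub R R, ∃ F : Finset X, (∀ x ∉ F, t x ∈ U.1) ∧
      ∀ a : X → R, (f U).1 a = ∑ x ∈ F, t x • U.1.mkQ (a x) := by
    intro U
    obtain ⟨W, hW⟩ := (f U).2
    obtain ⟨F, h1, h2⟩ := (isPowerOf_pi (R := R) X).exists_finset W
    refine ⟨F, fun x hx => ?_, fun a => ?_⟩
    · have : (f U).1 (Pi.single x 1) = 0 := hW (h1 x hx 1)
      rw [ht'] at this
      exact (Submodule.Quotient.mk_eq_zero _).1 this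
    · have h0 : (f U).1 (a - _) = 0 := hW (h2 a)
      rw [map_sub, sub_eq_zero] at h0
      rw [h0, map_sum]
      refine Finset.sum_congr rfl fun x _ => ?_
      have h3 : (Pi.single x (a x) : X → R) = a x • Pi.single x 1 := by
        rw [← Pi.single_smul, smul_eq_mul, mul_one]
      change (f U).1 (Pi.single x (a x)) = _
      rw [h3, map_smul, ht']
      refine (map_smul U.1.mkQ _ _).symm.trans (Eq.trans ?_ (map_smul U.1.mkQ _ _))
      rw [smul_eq_mul, smul_eq_mul, mul_comm]
  refine ⟨⟨t, fun I => ?_⟩, dual_hom_ext fun U => ?_⟩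
  · obtain ⟨F, hF, -⟩ := hfin (openSubOfIdeal I)
    refine F.finite_toSet.subset fun x hx => ?_
    by_contra h
    exact hx (hF x h)
  · dsimp only
    rw [dualι_linComb_proj, ← hf]
    refine congrArg toDual (Subtype.ext (LinearMap.ext fun a => ?_))
    obtain ⟨F, h1, h2⟩ := hfin U
    rw [h2, finLin_contHom_apply]
    refine finLin_eq_sum _ _ F fun x hx => ?_
    refine (map_smul U.1.mkQ (t x) (a x)).symm.trans ?_
    exact (Submodule.Quotient.mk_eq_zero _).2 (Ideal.mul_mem_right _ U.1 (h1 x hx))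

/-- The infinite linear combinations of the inclusions of the summands identify `R[[X]]` with the
set of morphisms from `C(R)` to a direct sum of copies of `C(R)`. -/
theorem linComb_bijective {X : Type u} {K : Comod R} (j : X → (Comod.C R ⟶ K))
    (hj : IsColimit (Cofan.mk K j)) :
    Function.Bijective fun t : Lin R X => Comod.linComb (Lin.map j t) := by
  classical
  let i : dual R (X → R) ≅ K := (isPowerOf_pi (R := R) X).isColimit.coconePointUniqueUpToIso hj
  have hi : ∀ x, dualMap (ContinuousLinearMap.proj (R := R) (φ := fun _ : X => R) x) ≫ i.hom =
      j x := fun x =>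
    (isPowerOf_pi (R := R) X).isColimit.comp_coconePointUniqueUpToIso_hom hj ⟨x⟩
  have h : (fun t : Lin R X => Comod.linComb (Lin.map j t)) = (fun g => g ≫ i.hom) ∘
      fun t : Lin R X => Comod.linComb (Lin.map
        (fun x : X => dualMap (ContinuousLinearMap.proj (R := R) (φ := fun _ : X => R) x)) t) := by
    funext t
    refine Eq.trans ?_ (Comod.linComb_comp _ _).symm
    refine congrArg Comod.linComb ((Lin.bind_bind t _ _).trans ?_).symm
    refine congrArg (Lin.bind t) (funext fun x => (Lin.unit_bind _ _).trans ?_)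
    exact congrArg (Lin.unit R) (hi x)
  rw [h]
  exact ((Iso.homToEquiv i).bijective).comp
    ⟨linComb_proj_injective X, linComb_proj_surjective X⟩

/-- The free contramodule of morphisms from `C(R)` to a direct sum of copies of `C(R)`. -/
theorem isIso_freeLift_Psi {X : Type u} {K : Comod R} (j : X → (Comod.C R ⟶ K))
    (hj : IsColimit (Cofan.mk K j)) :
    IsIso (Contra.freeLift (K := (Psi R).obj K) j) :=
  Contra.isIso_of_bijective _ (linComb_bijective j hj)

end HomCofreeBijective

end CoContra

namespace CoContra

/-! ### The topological module `Hom_R(P/IP, N)` and its evaluations -/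

section RedHom

variable {R : Type u} [CommRing R] [TopologicalSpace R] [IsLinearlyComplete R]

namespace Contra

/-- The contraaction as a linear map. -/
noncomputable def actLinear (P : Contra R) : Lin R P.A →ₗ[R] P.A where
  toFun := P.act
  map_add' := P.act_add
  map_smul' := P.act_smul

end Contra

omit [IsLinearlyComplete R] in
theorem Lin.sum_smul_unit_apply {X : Type v} [DecidableEq X] (t : X → R) (F : Finset X) (x : X) :
    (∑ y ∈ F, t y • Lin.unit R y).1 x = if x ∈ F then t x else 0 := by
  rw [AddSubmonoidClass.coe_finsetSum, Finset.sum_apply]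
  simp [Lin.unit, Pi.single_apply]

/-- A linear map that vanishes on `IP`, where `I` annihilates the target, commutes with infinite
linear combinations. -/
theorem redHom_act {P : Contra R} {N : FinMod R} (h : redHom P N) (t : Lin R P.A) :
    h.1 (P.act t) = finLin t h.1 := by
  classical
  obtain ⟨I, hI, hh⟩ := h.2
  have hF : ∀ p ∉ (t.2 I).toFinset, t.1 p ∈ I.1 := fun p hp => by simpa using hp
  generalize (t.2 I).toFinset = F at hF
  -- Subtracting the finitely many terms with coefficients outside `I` leaves a combination with all
  -- coefficients in `I`, which `h` kills.
  have h1 := hh (t - ∑ p ∈ F, t.1 p • Lin.unit R p) fun p => by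
    have : (t - ∑ p ∈ F, t.1 p • Lin.unit R p).1 p =
        t.1 p - (∑ p ∈ F, t.1 p • Lin.unit R p).1 p := rfl
    rw [this, Lin.sum_smul_unit_apply]
    split_ifs with hp
    · rw [sub_self]
      exact I.1.zero_mem
    · rw [sub_zero]
      exact hF p hp
  rw [Contra.act_sub, map_sub, sub_eq_zero] at h1
  rw [h1, finLin_eq_sum t h.1 F fun p hp => hI _ (hF p hp) _]
  have h2 : P.act (∑ p ∈ F, t.1 p • Lin.unit R p) = ∑ p ∈ F, t.1 p • p := by
    refine (map_sum P.actLinear _ _).trans (Finset.sum_congr rfl fun p _ => ?_)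
    refine (map_smul P.actLinear _ _).trans ?_
    exact congrArg _ (P.act_unit p)
  rw [h2, map_sum]
  simp only [map_smul]

/-- An open submodule of `redHom P N` contains all maps that vanish on some finite set. -/
theorem exists_finset_of_isOpen {P : Contra R} {N : FinMod R} (U : OpenSub R (redHom P N)) :
    ∃ S : Finset P.A, ∀ h : redHom P N, (∀ p ∈ S, h.1 p = 0) → h ∈ U.1 := by
  let : TopologicalSpace N.obj := ⊥
  obtain ⟨V, hV, hVU⟩ := isOpen_induced_iff.1 U.2.1
  have h0 : (0 : P.A → N.obj) ∈ V := by
    have : (0 : redHom P N) ∈ (fun (h : redHom P N) p => h.1 p) ⁻¹' V := by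
      rw [hVU]
      exact U.1.zero_mem
    exact this
  obtain ⟨S, u, hu, hS⟩ := isOpen_pi_iff.1 hV 0 h0
  refine ⟨S, fun h hh => ?_⟩
  have : h ∈ (fun (h : redHom P N) p => h.1 p) ⁻¹' V := hS fun p hp => by
    change h.1 p ∈ u p
    rw [hh p hp]
    exact (hu p hp).2
  rw [hVU] at this
  exact this

theorem continuous_redHom_eval {P : Contra R} {N : FinMod R} [TopologicalSpace N.obj]
    [DiscreteTopology N.obj] (p : P.A) : Continuous fun h : redHom P N => h.1 p := by
  -- The topology of `redHom P N` is defined from `⊥` on `N`, so an arbitrary discrete topology is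
  -- first replaced by `⊥`.
  rename_i T _
  obtain rfl : T = ⊥ := DiscreteTopology.eq_bot
  let : TopologicalSpace N.obj := ⊥
  exact (continuous_apply p).comp continuous_induced_dom

/-- The evaluation at an element of `P`. -/
noncomputable def redHomEval {P : Contra R} (N : FinMod R) (p : P.A) : contHom R (redHom P N) N :=
  ⟨LinearMap.applyₗ p ∘ₗ (redHom P N).subtype, mem_contHom_of_isOpen _ (by
    let : TopologicalSpace N.obj := ⊥
    have : DiscreteTopology N.obj := ⟨rfl⟩
    exact (isOpen_discrete {(0 : N.obj)}).preimage (continuous_redHom_eval p))⟩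

/-- This is the source of the compatibility of `contratensorElem` with the contraaction. -/
theorem redHomEval_act {P : Contra R} (N : FinMod R) (t : Lin R P.A) :
    redHomEval N (P.act t) = finLin t (redHomEval N) :=
  Subtype.ext <| LinearMap.ext fun h => (redHom_act h t).trans
    (finLin_contHom_apply t (redHomEval N) h).symm

end RedHom

/-! ### For free `P` this module is a power of `N` -/

section FreeRedHom

variable {R : Type u} [CommRing R] [TopologicalSpace R] [IsLinearlyComplete R]

namespace Contra

/-- The coefficient of an element of a free contramodule. -/
noncomputable def freeCoeff (R : Type u) [CommRing R] [TopologicalSpace R] [IsLinearlyComplete R]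
    {X : Type u} (x : X) : (free R X).A →ₗ[R] R where
  toFun := fun t : Lin R X => t.1 x
  map_add' := fun s t : Lin R X => by
    have h : (free R X).act (Lin.unit R s + Lin.unit R t) = s + t := by
      refine (Lin.add_bind _ _ _).trans ?_
      rw [Lin.unit_bind, Lin.unit_bind]
      rfl
    exact congrArg (fun t : Lin R X => t.1 x) h
  map_smul' := fun r (t : Lin R X) => by
    have h : (free R X).act (r • Lin.unit R t) = r • t := by
      refine (Lin.smul_bind _ _ _).trans ?_
      rw [Lin.unit_bind]
      rfl
    exact congrArg (fun t : Lin R X => t.1 x) h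

theorem freeCoeff_unit {X : Type u} [DecidableEq X] (x y : X) :
    freeCoeff R x (Lin.unit R y) = if x = y then 1 else 0 := by
  classical
  change (Lin.unit R y).1 x = _
  simp [Lin.unit, Pi.single_apply]

end Contra

variable {X : Type u} {N : FinMod R}

/-- The map `∑ r_x x ↦ r_x n`. -/
noncomputable def redHomIncl (x : X) : N.obj →ₗ[R] redHom (Contra.free R X) N where
  toFun n := ⟨(Contra.freeCoeff R x).smulRight n, by
    obtain ⟨I, hI⟩ := N.isBounded
    refine ⟨I, hI, fun t ht => hI _ ?_ n⟩
    exact Lin.bind_mem t id I ht x⟩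
  map_add' m n := by
    ext t
    exact smul_add _ m n
  map_smul' r n := by
    ext t
    exact smul_comm _ r n

theorem redHom_apply_eq_finLin (h : redHom (Contra.free R X) N) (t : Lin R X) :
    h.1 t = finLin t fun x => h.1 (Lin.unit R x) := by
  have h1 := redHom_act h (Lin.map (Lin.unit R) t)
  exact (congrArg h.1 (Contra.free_act_map_unit t)).symm.trans
    (h1.trans (N.isBounded.finLin_map t (Lin.unit R) h.1))

theorem isPowerOf_redHom [TopologicalSpace N.obj] [DiscreteTopology N.obj] :
    IsPowerOf (R := R) (T := N.obj) (H := redHom (Contra.free R X) N)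
      (fun x : X => ⟨(redHomEval N (Lin.unit R x : (Contra.free R X).A)).1,
        continuous_redHom_eval _⟩)
      (fun x : X => ⟨redHomIncl x, continuous_of_discreteTopology⟩) where
  proj_incl x n := by
    classical
    change Contra.freeCoeff R x (Lin.unit R x) • n = n
    rw [Contra.freeCoeff_unit, if_pos rfl, one_smul]
  proj_incl_of_ne x y hxy n := by
    classical
    change Contra.freeCoeff R x (Lin.unit R y) • n = 0
    rw [Contra.freeCoeff_unit, if_neg hxy, zero_smul]
  exists_finset U := by
    classical
    obtain ⟨S, hS⟩ := exists_finset_of_isOpen U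
    obtain ⟨I, hI⟩ := N.isBounded
    -- `U` only tests values on the finite set `S`. Each `p` in `S` has finitely many coefficients
    -- outside `I`, and `I` annihilates `N`, so the basis elements in `F` suffice.
    let F : Finset X := S.biUnion fun p : Lin R X => (p.2 I).toFinset
    have hF : ∀ p : Lin R X, p ∈ S → ∀ x ∉ F, p.1 x ∈ I.1 := fun p hp x hx => by
      by_contra h
      exact hx (Finset.mem_biUnion.2 ⟨p, hp, (p.2 I).mem_toFinset.2 h⟩)
    refine ⟨F, fun x hx n => hS _ fun p hp => hI _ (hF p hp x hx) n, fun h => hS _ fun p hp => ?_⟩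
    have h1 : h.1 p = ∑ x ∈ F, p.1 x • h.1 (Lin.unit R x) := by
      refine (redHom_apply_eq_finLin h p).trans ?_
      exact finLin_eq_sum _ _ F fun x hx => hI _ (hF p hp x hx) _
    refine sub_eq_zero.2 (h1.trans ?_)
    refine Eq.trans ?_ (map_sum ((redHomEval N p).1) _ _).symm
    rfl

end FreeRedHom

/-! ### A discrete module of finite length is its own dual comodule -/

section DiscreteDual

variable {R : Type u} [CommRing R] [TopologicalSpace R]
  {N : FinMod R} [TopologicalSpace N.obj] [DiscreteTopology N.obj]

variable (N) in
/-- The identity map of a discrete module of finite length. -/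
def idContHom : contHom R N.obj N :=
  ⟨LinearMap.id, mem_contHom_of_isOpen _ (isOpen_discrete _)⟩

instance isIso_toDual_id : IsIso (toDual (idContHom N)) := by
  have hk : LinearMap.ker (idContHom N).1 = ⊥ := LinearMap.ker_id
  let W : OpenSub R N.obj := ⟨⊥, isOpen_discrete _,
    isFin_of_injective (M := ModuleCat.of R (N.obj ⧸ (⊥ : Submodule R N.obj))) (N := N.obj)
      (Submodule.quotEquivOfEqBot ⊥ rfl).toLinearMap (LinearEquiv.injective _) N.property⟩
  rw [toDual_eq _ W hk.ge]
  have h1 : IsIso (OpenSub.desc W (idContHom N).1 hk.ge) :=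
    ⟨ObjectProperty.homMk (ModuleCat.ofHom (Submodule.mkQ ⊥)), OpenSub.hom_ext fun _ => rfl, by
      ext x
      rfl⟩
  -- The zero submodule is open, so it is the last stage of the system and the colimit is attained
  -- there.
  have h2 : IsIso (dualι W) :=
    isIso_ι_of_isTerminal (j := op W)
      (.ofUniqueHom (fun V => (homOfLE (show W ≤ V.unop from
        (bot_le : (⊥ : Submodule R N.obj) ≤ V.unop.1))).op)
        fun _ _ => Subsingleton.elim _ _) _
  infer_instance

end DiscreteDual

/-! ### Contratensor product of a free contramodule with a finite length comodule -/

section CoproductRedHom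

variable {R : Type u} [CommRing R] [TopologicalSpace R] [IsLinearlyComplete R]

/-- The contratensor product of a free contramodule with a comodule of finite length is a direct
sum of copies of the latter. -/
theorem existsUnique_redHom {X : Type u} {N : FinMod R} {M : Comod R}
    (m : X → (Comod.ofFin.obj (op N) ⟶ M)) :
    ∃! g : dual R (redHom (Contra.free R X) N) ⟶ M,
      ∀ x, toDual (redHomEval N (Lin.unit R x : (Contra.free R X).A)) ≫ g = m x := by
  let : TopologicalSpace N.obj := ⊥
  have : DiscreteTopology N.obj := ⟨rfl⟩
  have hp := isPowerOf_redHom (R := R) (X := X) (N := N)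
  have h : ∀ x : X, toDual (redHomEval N (Lin.unit R x : (Contra.free R X).A)) =
      toDual (idContHom N) ≫ dualMap (H := redHom (Contra.free R X) N)
        ⟨(redHomEval N (Lin.unit R x : (Contra.free R X).A)).1, continuous_redHom_eval _⟩ :=
    fun x => (toDual_dualMap _ _ _ rfl).symm
  -- The isomorphism between `N` and its dual comodule moves to the other side, leaving the
  -- universal property of a direct sum of copies of `dual R N`.
  simp only [h, Category.assoc, ← IsIso.eq_inv_comp]
  exact ⟨hp.desc _, hp.dualMap_desc _, fun g hg =>
    hp.hom_ext fun x => (hg x).trans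
      (hp.dualMap_desc (fun x => inv (toDual (idContHom N)) ≫ m x) x).symm⟩

end CoproductRedHom

end CoContra

namespace CoContra

/-! ### Universal property of pointwise left Kan extensions -/

section Lan

universe v₁ v₂ v₃ u₁ u₂ u₃

variable {C : Type u₁} {D : Type u₂} {E : Type u₃} [Category.{v₁} C] [Category.{v₂} D]
  [Category.{v₃} E] (L : C ⥤ D) [∀ F : C ⥤ E, L.HasPointwiseLeftKanExtension F]

/-- The structure morphisms of a left Kan extension as a colimit. -/
noncomputable def lanι (F : C ⥤ E) {c : C} {d : D} (x : L.obj c ⟶ d) :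
    F.obj c ⟶ (L.lan.obj F).obj d :=
  (L.lanUnit.app F).app c ≫ (L.lan.obj F).map x

theorem lanι_w (F : C ⥤ E) {c c' : C} {d : D} (k : c ⟶ c') (x : L.obj c' ⟶ d) :
    lanι L F (L.map k ≫ x) = F.map k ≫ lanι L F x := by
  have h : F.map k ≫ (L.lanUnit.app F).app c' =
      (L.lanUnit.app F).app c ≫ (L.lan.obj F).map (L.map k) :=
    (L.lanUnit.app F).naturality k
  have h' := congrArg (· ≫ (L.lan.obj F).map x) h
  simp only [Category.assoc] at h'
  rw [lanι, lanι, Functor.map_comp]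
  exact h'.symm

theorem lanι_map {F G : C ⥤ E} (α : F ⟶ G) {c : C} {d : D} (x : L.obj c ⟶ d) :
    lanι L F x ≫ (L.lan.map α).app d = α.app c ≫ lanι L G x := by
  have h : α.app c ≫ (L.lanUnit.app G).app c =
      (L.lanUnit.app F).app c ≫ (L.lan.map α).app (L.obj c) :=
    congrArg (fun a => a.app c) (L.lanUnit.naturality α)
  have h' := congrArg (· ≫ (L.lan.obj G).map x) h
  simp only [Category.assoc] at h'
  rw [lanι, lanι, Category.assoc, (L.lan.map α).naturality x]
  exact h'.symm

theorem existsUnique_lan_hom (F : C ⥤ E) {d : D} {Z : E}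
    (φ : ∀ c : C, (L.obj c ⟶ d) → (F.obj c ⟶ Z))
    (hφ : ∀ (c c' : C) (k : c ⟶ c') (x : L.obj c' ⟶ d), φ c (L.map k ≫ x) = F.map k ≫ φ c' x) :
    ∃! g : (L.lan.obj F).obj d ⟶ Z, ∀ (c : C) (x : L.obj c ⟶ d), lanι L F x ≫ g = φ c x := by
  have hc := Functor.isPointwiseLeftKanExtensionOfIsLeftKanExtension
    (L := L) (F := F) (L.lan.obj F) (L.lanUnit.app F) d
  let s : Cocone (CostructuredArrow.proj L d ⋙ F) :=
    { pt := Z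
      ι :=
        { app := fun a => φ a.left a.hom
          naturality := fun a b k => by
            refine Eq.trans ?_ (Category.comp_id _).symm
            exact (hφ _ _ k.left b.hom).symm.trans (congrArg (φ a.left) (CostructuredArrow.w k)) } }
  refine ⟨hc.desc s, fun c x => ?_, fun g hg => ?_⟩
  · exact hc.fac s (CostructuredArrow.mk x)
  · exact hc.uniq s g fun a => hg a.left a.hom

end Lan

/-! ### Elements of `P` as morphisms `M ⟶ P ⊙ M`, and the free case -/

section Contratensor

variable {R : Type u} [CommRing R] [TopologicalSpace R] [IsLinearlyComplete R]

/-- The structure morphism of the contratensor product as a colimit. -/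
noncomputable def contratensorι (P : Contra R) {M : Comod R} {N : (FinMod R)ᵒᵖ}
    (x : Comod.ofFin.obj N ⟶ M) :
    dual R (redHom P N.unop) ⟶ (contratensor.obj P).obj M :=
  lanι Comod.ofFin (contratensorFin.obj P) x

theorem contratensorι_w (P : Contra R) {M : Comod R} {N N' : (FinMod R)ᵒᵖ} (k : N ⟶ N')
    (x : Comod.ofFin.obj N' ⟶ M) :
    contratensorι P (Comod.ofFin.map k ≫ x) =
      dualMap (redHomMap (𝟙 P) k.unop) ≫ contratensorι P x :=
  lanι_w Comod.ofFin (contratensorFin.obj P) k x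

theorem contratensorι_map {P Q : Contra R} (g : P ⟶ Q) {M : Comod R} {N : (FinMod R)ᵒᵖ}
    (x : Comod.ofFin.obj N ⟶ M) :
    contratensorι P x ≫ (contratensor.map g).app M =
      dualMap (redHomMap g (𝟙 N.unop)) ≫ contratensorι Q x :=
  lanι_map Comod.ofFin (contratensorFin.map g) x

theorem existsUnique_contratensor_hom (P : Contra R) {M Z : Comod R}
    (φ : ∀ N : (FinMod R)ᵒᵖ, (Comod.ofFin.obj N ⟶ M) → (dual R (redHom P N.unop) ⟶ Z))
    (hφ : ∀ (N N' : (FinMod R)ᵒᵖ) (k : N ⟶ N') (x : Comod.ofFin.obj N' ⟶ M),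
      φ N (Comod.ofFin.map k ≫ x) = dualMap (redHomMap (𝟙 P) k.unop) ≫ φ N' x) :
    ∃! g : (contratensor.obj P).obj M ⟶ Z, ∀ (N : (FinMod R)ᵒᵖ) (x : Comod.ofFin.obj N ⟶ M),
      contratensorι P x ≫ g = φ N x :=
  existsUnique_lan_hom Comod.ofFin (contratensorFin.obj P) φ hφ

/-- The evaluations at an element are natural. -/
theorem toDual_redHomEval_dualMap {P Q : Contra R} (g : P ⟶ Q) (p : P.A) {N N' : FinMod R}
    (k : N ⟶ N') :
    toDual (redHomEval N' p) ≫ dualMap (redHomMap g k) =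
      Comod.ofFin.map k.op ≫ toDual (redHomEval N (g.f p)) := by
  let f : contHom R (redHom Q N) N' :=
    ⟨k.hom.hom ∘ₗ (redHomEval N (g.f p)).1, (redHomEval N (g.f p)).2.choose, fun a ha => by
      have h0 : (redHomEval N (g.f p)).1 a = 0 := (redHomEval N (g.f p)).2.choose_spec ha
      exact (congrArg k.hom.hom h0).trans (map_zero _)⟩
  exact (toDual_dualMap _ _ f rfl).trans (comp_toDual k _ f rfl).symm

/-- Evaluation at `p` is natural in `N`, so the prescribed restrictions to objects of finite length
are compatible and determine a morphism. -/
theorem existsUnique_contratensorElem {P : Contra R} (M : Comod R) (p : P.A) :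
    ∃! g : M ⟶ (contratensor.obj P).obj M,
      ∀ (N : (FinMod R)ᵒᵖ) (x : Comod.ofFin.obj N ⟶ M),
        x ≫ g = toDual (redHomEval N.unop p) ≫ contratensorι P x :=
  existsUnique_ind_hom _ fun X Y k x => by
    have h := congrArg (toDual (redHomEval X.unop p) ≫ ·) (contratensorι_w P k x)
    have h2 := congrArg (· ≫ contratensorι P x) (toDual_redHomEval_dualMap (𝟙 P) p k.unop)
    simp only [Category.assoc] at h2
    exact h.trans h2

/-- The morphism `M ⟶ P ⊙ M` given by an element of `P`. -/
noncomputable def contratensorElem {P : Contra R} (M : Comod R) (p : P.A) :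
    M ⟶ (contratensor.obj P).obj M :=
  (existsUnique_contratensorElem M p).choose

theorem comp_contratensorElem {P : Contra R} {M : Comod R} (p : P.A) {N : FinMod R}
    (x : Comod.ofFin.obj (op N) ⟶ M) :
    x ≫ contratensorElem M p = toDual (redHomEval N p) ≫ contratensorι P x :=
  (existsUnique_contratensorElem M p).choose_spec.1 (op N) x

theorem contratensorElem_map {P Q : Contra R} (g : P ⟶ Q) (M : Comod R) (p : P.A) :
    contratensorElem M p ≫ (contratensor.map g).app M = contratensorElem M (g.f p) :=
  Comod.hom_ext_ofFin fun N x => by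
    rw [← Category.assoc, comp_contratensorElem, comp_contratensorElem, Category.assoc,
      contratensorι_map]
    have h := congrArg (· ≫ contratensorι Q x) (toDual_redHomEval_dualMap g p (𝟙 N))
    simp only [Category.assoc] at h
    refine h.trans ?_
    exact (congrArg (· ≫ _) (Comod.ofFin.map_id (op N))).trans (Category.id_comp _)

/-- Needed for the unit to be a morphism of contramodules. After restriction to finite length it
follows from `redHomEval_act`, since `toDual` and postcomposition are linear. -/
theorem contratensorElem_act (P : Contra R) (M : Comod R) (t : Lin R P.A) :
    contratensorElem M (P.act t) = Comod.linComb (Lin.map (contratensorElem M) t) :=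
  Comod.hom_ext_ofFin fun N x => by
    rw [Comod.comp_linComb, (Comod.isBounded_hom N _).finLin_map]
    simp only [comp_contratensorElem]
    rw [redHomEval_act]
    have h1 := (isBounded_contHom (redHom P N) N).map_finLin
      (toDualLinear R (redHom P N) N) t (redHomEval N)
    have h2 := (Comod.isBounded_hom N _).map_finLin (Comod.postcomp N (contratensorι P x)) t
      fun p => toDual (redHomEval N p)
    exact (congrArg (· ≫ contratensorι P x) h1).trans h2

/-- If `P` is free with basis `X`, then `P ⊙ M` is a direct sum of copies of `M`. -/
noncomputable def isColimitContratensorFree (X : Type u) (M : Comod R) :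
    IsColimit (Cofan.mk ((contratensor.obj (Contra.free R X)).obj M) fun x : X =>
      contratensorElem M (Lin.unit R x : (Contra.free R X).A)) := by
  have key : ∀ {Z : Comod R} (m : X → (M ⟶ Z)),
      ∃! g : (contratensor.obj (Contra.free R X)).obj M ⟶ Z,
        ∀ x, contratensorElem M (Lin.unit R x : (Contra.free R X).A) ≫ g = m x := by
    intro Z m
    -- At each `y : N ⟶ M` the direct sum decomposition of `R[[X]] ⊙ N` assembles the `y ≫ m x` into
    -- `φ N y`; its uniqueness then gives naturality.
    choose φ hφ hφ' using fun (N : (FinMod R)ᵒᵖ) (y : Comod.ofFin.obj N ⟶ M) =>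
      existsUnique_redHom (N := N.unop) fun x => y ≫ m x
    dsimp only at hφ'
    obtain ⟨g, hg, hg'⟩ := existsUnique_contratensor_hom (Contra.free R X) φ
      fun N N' k y => (hφ' _ _ _ fun x => by
        have h := congrArg (· ≫ φ N' y) (toDual_redHomEval_dualMap (𝟙 (Contra.free R X))
          (Lin.unit R x : (Contra.free R X).A) k.unop)
        simp only [Category.assoc] at h
        refine h.trans ?_
        rw [Category.assoc]
        exact congrArg (Comod.ofFin.map k ≫ ·) (hφ N' y x)).symm
    have hcomp : ∀ (N : FinMod R) (y : Comod.ofFin.obj (op N) ⟶ M) (x : X)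
        {g : (contratensor.obj (Contra.free R X)).obj M ⟶ Z},
        toDual (redHomEval N (Lin.unit R x : (Contra.free R X).A)) ≫ contratensorι _ y ≫ g =
          y ≫ contratensorElem M (Lin.unit R x : (Contra.free R X).A) ≫ g := fun N y x g => by
      have h := congrArg (· ≫ g)
        (comp_contratensorElem (P := Contra.free R X) (Lin.unit R x) y)
      simp only [Category.assoc] at h
      exact h.symm
    refine ⟨g, fun x => Comod.hom_ext_ofFin fun N y => ?_, fun g' h' => hg' _ fun N y => ?_⟩
    · rw [← hcomp N y x, hg]
      exact hφ (op N) y x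
    · refine hφ' N y _ fun x => ?_
      rw [hcomp N.unop y x]
      exact congrArg (y ≫ ·) (h' x)
  exact Cofan.IsColimit.mk _ (fun s => (key s.inj).choose) (fun s => (key s.inj).choose_spec.1)
    fun s m hm => (key s.inj).choose_spec.2 m hm

end Contratensor

end CoContra

namespace CoContra

/-! ### The equivalence and its additivity -/

section Equivalence

variable (R : Type u) [CommRing R] [TopologicalSpace R]

/-- The unit of the adjunction of the functors `Φ_R` and `Ψ_R`. -/
noncomputable def unitPhiPsi [IsLinearlyComplete R] : 𝟭 (Contra R) ⟶ Phi R ⋙ Psi R where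
  app P := Contra.homMk (Q := (Psi R).obj ((Phi R).obj P)) (contratensorElem (Comod.C R))
    (contratensorElem_act P (Comod.C R))
  naturality P Q g := by
    ext p
    exact (contratensorElem_map g (Comod.C R) p).symm

variable [IsProArtinian R]

theorem isIso_unitPhiPsi_free (X : Type u) : IsIso ((unitPhiPsi R).app (Contra.free R X)) := by
  let K : Contra R := (Psi R).obj ((Phi R).obj (Contra.free R X))
  let j : X → K.A := fun x => contratensorElem (Comod.C R) (Lin.unit R x : (Contra.free R X).A)
  -- The unit sends basis elements to the inclusions of the summands of `Φ(R[[X]])`, so it is the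
  -- isomorphism of `isIso_freeLift_Psi`.
  have e : (unitPhiPsi R).app (Contra.free R X) = Contra.freeLift j :=
    Contra.free_hom_ext (K := K) fun x => (Contra.freeLift_unit j x).symm
  rw [e]
  exact isIso_freeLift_Psi _ (isColimitContratensorFree X (Comod.C R))

theorem isIso_unitPhiPsi (P : Contra R) (hP : Contra.isFree R P) :
    IsIso ((unitPhiPsi R).app P) := by
  obtain ⟨X, ⟨i⟩⟩ := hP
  exact (NatTrans.isIso_app_iff_of_iso _ i).2 (isIso_unitPhiPsi_free R X)

omit [IsProArtinian R] in
theorem isCofree_of_isColimit [IsLinearlyComplete R] {X : Type u} {K : Comod R} {j : X → (Comod.C R ⟶ K)}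
    (hj : IsColimit (Cofan.mk K j)) : isCofree R K :=
  ⟨X, ⟨hj.coconePointUniqueUpToIso (colimit.isColimit _)⟩⟩

omit [IsProArtinian R] in
theorem exists_isColimit_of_isCofree [IsLinearlyComplete R] {K : Comod R} (hK : isCofree R K) :
    ∃ (X : Type u) (j : X → (Comod.C R ⟶ K)), Nonempty (IsColimit (Cofan.mk K j)) := by
  obtain ⟨X, ⟨i⟩⟩ := hK
  refine ⟨X, fun x => Sigma.ι (fun _ : X => Comod.C R) x ≫ i.inv, ⟨?_⟩⟩
  exact IsColimit.ofIsoColimit (coproductIsCoproduct fun _ : X => Comod.C R)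
    (Cofan.ext i.symm fun _ => rfl)

theorem isCofree_Phi (P : Contra R) (hP : Contra.isFree R P) : isCofree R ((Phi R).obj P) := by
  obtain ⟨X, ⟨i⟩⟩ := hP
  obtain ⟨Y, ⟨k⟩⟩ := isCofree_of_isColimit R (isColimitContratensorFree X (Comod.C R))
  exact ⟨Y, ⟨(Phi R).mapIso i ≪≫ k⟩⟩

theorem isFree_Psi (M : Comod R) (hM : isCofree R M) : Contra.isFree R ((Psi R).obj M) := by
  obtain ⟨X, j, ⟨hj⟩⟩ := exists_isColimit_of_isCofree R hM
  have := isIso_freeLift_Psi j hj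
  exact ⟨X, ⟨(asIso (Contra.freeLift (K := (Psi R).obj M) j)).symm⟩⟩

/-- With `M` a direct sum of copies of `C(R)` and `Ψ M` free on the inclusions `j x`, morphisms out
of either are determined by an arbitrary family of morphisms `C(R) ⟶ N`. -/
theorem Psi_map_bijective (M N : Comod R) (hM : isCofree R M) :
    Function.Bijective ((Psi R).map : (M ⟶ N) → _) := by
  obtain ⟨X, j, ⟨hj⟩⟩ := exists_isColimit_of_isCofree R hM
  refine ⟨fun f g h => Cofan.IsColimit.hom_ext hj _ _ fun x => ?_, fun φ => ?_⟩
  · exact ConcreteCategory.congr_hom (congrArg Monad.Algebra.Hom.f h) (j x)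
  · have := isIso_freeLift_Psi j hj
    refine ⟨Cofan.IsColimit.desc hj fun x => φ.f (j x), ?_⟩
    rw [← cancel_epi (Contra.freeLift (K := (Psi R).obj M) j)]
    refine Contra.free_hom_ext fun x => ?_
    have h := Contra.freeLift_unit (K := (Psi R).obj M) j x
    refine (congrArg ((Psi R).map _).f h).trans (Eq.trans ?_ (congrArg φ.f h).symm)
    exact Cofan.IsColimit.fac hj _ x

/-- The functor from free contramodules to cofree comodules. -/
noncomputable abbrev freePhi : FreeContra R ⥤ CofreeComod R :=
  (isCofree R).lift ((Contra.isFree R).ι ⋙ Phi R) fun P => isCofree_Phi R P.obj P.property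

/-- The functor from cofree comodules to free contramodules. -/
noncomputable abbrev cofreePsi : CofreeComod R ⥤ FreeContra R :=
  (Contra.isFree R).lift ((isCofree R).ι ⋙ Psi R) fun M => isFree_Psi R M.obj M.property

instance : (cofreePsi R).Faithful where
  map_injective {M N} _ _ h := (isCofree R).ι.map_injective <|
    (Psi_map_bijective R M.obj N.obj M.property).1 (congrArg (Contra.isFree R).ι.map h)

instance : (cofreePsi R).Full where
  map_surjective {M N} φ := by
    obtain ⟨f, hf⟩ := (Psi_map_bijective R M.obj N.obj M.property).2 φ.hom
    exact ⟨ObjectProperty.homMk f, (Contra.isFree R).ι.map_injective hf⟩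

/-- A free contramodule is recovered from the corresponding cofree comodule. -/
noncomputable def freePhiPsiIso : 𝟭 (FreeContra R) ≅ freePhi R ⋙ cofreePsi R :=
  NatIso.ofComponents
    (fun P => have := isIso_unitPhiPsi R P.obj P.property
      (Contra.isFree R).fullyFaithfulι.preimageIso (asIso ((unitPhiPsi R).app P.obj)))
    fun g => (Contra.isFree R).ι.map_injective ((unitPhiPsi R).naturality g.hom)

instance : (cofreePsi R).EssSurj where
  mem_essImage P := ⟨(freePhi R).obj P, ⟨((freePhiPsiIso R).app P).symm⟩⟩

instance : (cofreePsi R).IsEquivalence where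

/-- The equivalence of the categories of free contramodules and cofree comodules. -/
noncomputable def freeCofreeEquivalence : FreeContra R ≌ CofreeComod R :=
  -- The abstract quasi-inverse of `Ψ` is replaced by the isomorphic functor `freePhi`, so that both
  -- functors of the equivalence are literally the restrictions of `Φ` and `Ψ`.
  (cofreePsi R).asEquivalence.symm.changeFunctor <|
    (Functor.leftUnitor _).symm ≪≫ Functor.isoWhiskerRight (freePhiPsiIso R) (cofreePsi R).inv ≪≫
      Functor.associator _ _ _ ≪≫
      Functor.isoWhiskerLeft (freePhi R) (cofreePsi R).asEquivalence.unitIso.symm ≪≫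
      Functor.rightUnitor _

instance : (isCofree R).IsClosedUnderIsomorphisms where
  of_iso i := fun ⟨X, ⟨k⟩⟩ => ⟨X, ⟨i.symm ≪≫ k⟩⟩

/-- A finite direct sum of direct sums of copies of `C(R)` is one over the disjoint union of the
index sets. -/
instance (J : Type) [Finite J] : (isCofree R).IsClosedUnderColimitsOfShape (Discrete J) :=
  .mk' (by
    rintro _ ⟨F, hF⟩
    choose X i using hF
    exact ⟨Σ j : J, X ⟨j⟩, ⟨HasColimit.isoOfNatIso Discrete.natIsoFunctor ≪≫
      Sigma.mapIso (fun j => (i ⟨j⟩).some) ≪≫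
      sigmaSigmaIso (fun j : J => X ⟨j⟩) fun _ _ => Comod.C R⟩⟩)

theorem hasFiniteBiproducts_cofreeComod : HasFiniteBiproducts (CofreeComod R) :=
  have : HasFiniteCoproducts (CofreeComod R) := ⟨fun _ => inferInstance⟩
  .of_hasFiniteCoproducts

/-- Finite coproducts are transported along the equivalence; preadditivity makes them biproducts. -/
theorem hasFiniteBiproducts_freeContra : HasFiniteBiproducts (FreeContra R) :=
  have := hasFiniteBiproducts_cofreeComod R
  have : HasFiniteCoproducts (FreeContra R) :=
    ⟨fun _ => Adjunction.hasColimitsOfShape_of_equivalence (freeCofreeEquivalence R).functor⟩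
  .of_hasFiniteCoproducts

end Equivalence

end CoContra

theorem mainTheorem3 (R : Type u) [CommRing R] [TopologicalSpace R] [CoContra.IsProArtinian R] :
    HasFiniteBiproducts (CoContra.FreeContra R) ∧
    HasFiniteBiproducts (CoContra.CofreeComod R) ∧
    ∃ (hΦ : ∀ P : CoContra.Contra R, CoContra.Contra.isFree R P →
          CoContra.isCofree R ((CoContra.Phi R).obj P))
      (hΨ : ∀ M : CoContra.Comod R, CoContra.isCofree R M →
          CoContra.Contra.isFree R ((CoContra.Psi R).obj M))
      (e : CoContra.FreeContra R ≌ CoContra.CofreeComod R),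
      e.functor = (CoContra.isCofree R).lift ((CoContra.Contra.isFree R).ι ⋙ CoContra.Phi R)
        (fun P => hΦ P.obj P.property) ∧
      e.inverse = (CoContra.Contra.isFree R).lift ((CoContra.isCofree R).ι ⋙ CoContra.Psi R)
        (fun M => hΨ M.obj M.property) ∧
      e.functor.Additive ∧ e.inverse.Additive := by
  have := CoContra.hasFiniteBiproducts_freeContra R
  have := CoContra.hasFiniteBiproducts_cofreeComod R
  exact ⟨inferInstance, inferInstance, CoContra.isCofree_Phi R, CoContra.isFree_Psi R,
    CoContra.freeCofreeEquivalence R, rfl, rfl,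
    -- An equivalence preserves binary products, which forces additivity once the biproducts are
    -- available.
    Functor.additive_of_preserves_binary_products _,
    Functor.additive_of_preserves_binary_products _⟩
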